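/- An $\ell$-group is a Hausdorff, locally compact, totally disconnected topological group; it is an $\ell_c$-group if it is the filtered union of its compact open subgroups (every element lies in one, and any two are contained in a third). A complex representation $(\pi,V)$ of an $\ell$-group $G$ is smooth if every vector has open stabilizer, and admissible if moreover $V^K$ is finite-dimensional for every compact open subgroup $K\subset G$; $G$ is tame if all its irreducible smooth representations are admissible. Let $\widehat G$ be the set of isomorphism classes of irreducible smooth representations of $G$ with the Fell topology, generated by the sets $\mathscr U(\pi,v_j,\xi_j,B,\varepsilon)$ (for $(\pi,V)\in\widehat G$, $v_1,\dots,v_n\in V$, $\xi_1,\dots,\xi_n$ in the smooth dual $V^\vee$ of $V$, $B\subset G$ compact, $\varepsilon>0$) of all $(\sigma,W)\in\widehat G$ for which there are $w_1,\dots,w_n\in W$ and $\zeta_1,\dots,\zeta_n\in W^\vee$ with $|\langle\xi_j,\pi(g)v_j\rangle-\langle\zeta_j,\sigma(g)w_j\rangle|<\varepsilon$ for all $1\le j\le n$ and $g\in B$. Let $\mathcal R(G)$ be the category of smooth representations of $G$, and for a subset $W\subset\widehat G$ let $\mathcal R(G)_W$ be the full subcategory of those $M$ whose support $\{\pi\in\widehat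 G : \operatorname{Hom}_G(M,\pi)\ne 0\}$ is contained in $W$. Let $\mathscr Z(G)$ and $\mathscr Z_W(G)$ be the Bernstein centers of $\mathcal R(G)$ and $\mathcal R(G)_W$, that is, the $\mathbb C$-algebras of endomorphisms of their identity functors. If $G$ is a tame $\ell_c$-group, then the endomorphisms of each $\pi\in\widehat G$ are scalars (Schur's lemma), so letting an element of the center act on each $\pi$ defines natural algebra homomorphisms $\mathscr Z_W(G)\to\operatorname{Fun}(W)$ and $\mathscr Z(G)\to\operatorname{Fun}(\widehat G)$ to the algebras of all $\mathbb C$-valued functions. **Theorem.** Let $G$ be a tame $\ell_c$-group. For every locally closed subset $W\subset\widehat G$, the image of the natural homomorphism $\mathscr Z_W(G)\to\operatorname{Fun}(W)$ is exactly the algebra $C^\infty(W)$ of locally constant $\mathbb C$-valued functions on $W$ (with the subspace topology). Moreover, the natural homomorphism $\mathscr Z(G)\to\operatorname{Fun}(\widehat G)$ is an isomorphism of $\mathbb C$-algebras from $\mathscr Z(G)$ onto $C^\infty(\widehat G)$. -/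

import Mathlib

open CategoryTheory Topology

universe u

noncomputable section

namespace SmoothRep

/-! ### Groups -/

/-- An `ℓ`-group: a topological group whose underlying space is Hausdorff, locally compact and
totally disconnected. -/
class IsEllGroup (G : Type u) [Group G] [TopologicalSpace G] : Prop extends
  IsTopologicalGroup G, T2Space G, LocallyCompactSpace G, TotallyDisconnectedSpace G

/-- An `ℓ_c`-group: an `ℓ`-group which is the filtered union of its compact open subgroups. -/
class IsEllCGroup (G : Type u) [Group G] [TopologicalSpace G] : Prop extends IsEllGroup G where
  exists_mem : ∀ g : G, ∃ K : Subgroup G,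
    IsOpen (K : Set G) ∧ IsCompact (K : Set G) ∧ g ∈ K
  directed : ∀ K L : Subgroup G, IsOpen (K : Set G) → IsCompact (K : Set G) →
    IsOpen (L : Set G) → IsCompact (L : Set G) →
      ∃ M : Subgroup G, IsOpen (M : Set G) ∧ IsCompact (M : Set G) ∧ K ≤ M ∧ L ≤ M

/-! ### Smooth and admissible representations -/

section Representations

variable {G : Type u} [Group G] [TopologicalSpace G] {V : Type u} [AddCommGroup V] [Module ℂ V]

/-- A vector is smooth if its stabilizer is open. -/
def IsSmoothVector (ρ : Representation ℂ G V) (v : V) : Prop :=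
  IsOpen {g : G | ρ g v = v}

/-- A complex representation is smooth if all its vectors are smooth (equivalently, the action map
`G × V → V` is continuous for the discrete topology on `V`). -/
def IsSmooth (ρ : Representation ℂ G V) : Prop :=
  ∀ v : V, IsSmoothVector ρ v

/-- A representation is admissible if it is smooth and the vectors fixed by any compact open
subgroup form a finite-dimensional space. -/
def IsAdmissible (ρ : Representation ℂ G V) : Prop :=
  IsSmooth ρ ∧ ∀ K : Subgroup G, IsOpen (K : Set G) → IsCompact (K : Set G) →
    FiniteDimensional ℂ (Representation.invariants (ρ.comp K.subtype))

end Representations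

/-- A group is tame if all its irreducible smooth representations are admissible. (An irreducible
representation of `G` is spanned by the orbit of a vector, so it is isomorphic to one in the
universe of `G`.) -/
class IsTame (G : Type u) [Group G] [TopologicalSpace G] : Prop where
  admissible : ∀ M : Rep.{u} ℂ G, IsSmooth M.ρ → M.ρ.IsIrreducible → IsAdmissible M.ρ

/-! ### The smooth dual and its Fell topology -/

section Dual

variable (G : Type u) [Group G] [TopologicalSpace G]

/-- The irreducible smooth representations of `G`. -/
abbrev IrreducibleSmooth : Type (u + 1) :=
  {M : Rep.{u} ℂ G // IsSmooth M.ρ ∧ M.ρ.IsIrreducible}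

/-- Isomorphism of irreducible smooth representations. -/
instance irreducibleSmoothSetoid : Setoid (IrreducibleSmooth G) where
  r M N := Nonempty (M.1 ≅ N.1)
  iseqv := ⟨fun _ => ⟨Iso.refl _⟩, fun ⟨e⟩ => ⟨e.symm⟩, fun ⟨e⟩ ⟨f⟩ => ⟨e.trans f⟩⟩

/-- The smooth dual: isomorphism classes of irreducible smooth representations of `G`. -/
def SmoothDual : Type (u + 1) := Quotient (irreducibleSmoothSetoid G)

variable {G}

/-- The class in the smooth dual of an irreducible smooth representation. -/
def SmoothDual.mk (M : IrreducibleSmooth G) : SmoothDual G := Quotient.mk _ M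

/-- A representation in the isomorphism class `π`. -/
def SmoothDual.rep (π : SmoothDual G) : Rep.{u} ℂ G := (Quotient.out π).1

theorem SmoothDual.isSmooth_rep (π : SmoothDual G) : IsSmooth π.rep.ρ := (Quotient.out π).2.1

instance SmoothDual.isIrreducible_rep (π : SmoothDual G) : π.rep.ρ.IsIrreducible :=
  (Quotient.out π).2.2

theorem SmoothDual.nonempty_iso_rep_mk (M : IrreducibleSmooth G) :
    Nonempty ((SmoothDual.mk M).rep ≅ M.1) :=
  Quotient.mk_out (s := irreducibleSmoothSetoid G) M

theorem SmoothDual.eq_of_iso {π σ : SmoothDual G} (e : π.rep ≅ σ.rep) : π = σ :=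
  Quotient.out_equiv_out.1 ⟨e⟩

/-- The set `U(π, v_j, ξ_j, B, ε)` of those `σ` in the smooth dual which have matrix coefficients,
given by vectors `w_j` and smooth functionals `ζ_j`, that are `ε`-close on `B` to the matrix
coefficients of `π` given by `v_j` and `ξ_j`. -/
def fellNhd (π : SmoothDual G) {n : ℕ} (v : Fin n → π.rep) (ξ : Fin n → Module.Dual ℂ π.rep)
    (B : Set G) (ε : ℝ) : Set (SmoothDual G) :=
  {σ | ∃ (w : Fin n → σ.rep) (ζ : Fin n → Module.Dual ℂ σ.rep),
    (∀ j, IsSmoothVector σ.rep.ρ.dual (ζ j)) ∧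
      ∀ j, ∀ g ∈ B, ‖ξ j (π.rep.ρ g (v j)) - ζ j (σ.rep.ρ g (w j))‖ < ε}

/-- The Fell topology: the topology generated by the sets `U(π, v_j, ξ_j, B, ε)` with `ξ_j` in the
smooth dual of `π`, with `B` compact and `ε > 0`. -/
instance fellTopology : TopologicalSpace (SmoothDual G) :=
  TopologicalSpace.generateFrom
    {U | ∃ (π : SmoothDual G) (n : ℕ) (v : Fin n → π.rep) (ξ : Fin n → Module.Dual ℂ π.rep)
      (B : Set G) (ε : ℝ), (∀ j, IsSmoothVector π.rep.ρ.dual (ξ j)) ∧ IsCompact B ∧ 0 < ε ∧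
        U = fellNhd π v ξ B ε}

/-! ### Categories of smooth representations -/

/-- The support of a representation `M`: all `π` with `Hom_G(M, π) ≠ 0`. -/
def support (M : Rep.{u} ℂ G) : Set (SmoothDual G) :=
  {π | ∃ f : M ⟶ π.rep, f ≠ 0}

variable (G) in
/-- Smoothness as a property of objects of the category of all representations. -/
def smooth : ObjectProperty (Rep.{u} ℂ G) := fun M => IsSmooth M.ρ

variable (G) in
/-- The category `R(G)` of smooth representations of `G`. -/
abbrev SmoothCat : Type (u + 1) := (smooth G).FullSubcategory

/-- The property of being smooth with support contained in `W`. -/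
def smoothOn (W : Set (SmoothDual G)) : ObjectProperty (Rep.{u} ℂ G) :=
  fun M => IsSmooth M.ρ ∧ support M ⊆ W

/-- The category `R(G)_W` of smooth representations of `G` with support contained in `W`. -/
abbrev SmoothCatOn (W : Set (SmoothDual G)) : Type (u + 1) := (smoothOn W).FullSubcategory

theorem smooth_rep (π : SmoothDual G) : smooth G π.rep := π.isSmooth_rep

theorem mem_support_rep {π σ : SmoothDual G} (h : σ ∈ support π.rep) : σ = π := by
  obtain ⟨f, hf⟩ := h
  have hb : Function.Bijective f.hom :=
    (Representation.IsIrreducible.bijective_or_eq_zero f.hom).resolve_right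
      fun h0 => hf (Rep.hom_ext h0)
  exact (SmoothDual.eq_of_iso
    (Rep.mkIso (Representation.IntertwiningMap.ofBijective f.hom hb))).symm

theorem smoothOn_rep {W : Set (SmoothDual G)} (π : W) : smoothOn W π.1.rep :=
  ⟨π.1.isSmooth_rep, fun _ hσ => mem_support_rep hσ ▸ π.2⟩

end Dual

/-! ### The Bernstein center and its action by scalars -/

section Center

variable {G : Type u} [Group G] [TopologicalSpace G]

/-- Schur's lemma: the endomorphisms of an irreducible smooth representation of a tame
`ℓ_c`-group are the scalars. -/
theorem schur [IsEllCGroup G] [IsTame G] (π : SmoothDual G) :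
    Function.Bijective (algebraMap ℂ (End π.rep)) := by
  have : Nontrivial π.rep := by
    by_contra hn
    rw [not_nontrivial_iff_subsingleton] at hn
    exact bot_ne_top (α := Subrepresentation π.rep.ρ)
      (SetLike.ext fun x => by
        rw [Subsingleton.elim x 0]
        exact iff_of_true (Submodule.zero_mem _) (Submodule.zero_mem _))
  obtain ⟨v, hv⟩ := exists_ne (0 : π.rep)
  have hhom : ∀ (c : ℂ) (x : π.rep),
      Rep.Hom.hom (algebraMap ℂ (End π.rep) c : π.rep ⟶ π.rep) x = c • x := fun _ _ => rfl
  refine ⟨fun a b hab => ?_, fun f => ?_⟩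
  · have h := congrArg (fun t : End π.rep => Rep.Hom.hom (t : π.rep ⟶ π.rep) v) hab
    simp only [hhom] at h
    exact smul_left_injective ℂ hv h
  -- a compact open subgroup fixing a nonzero vector
  obtain ⟨K, hKo, hKc, -⟩ := IsEllCGroup.exists_mem (1 : G)
  let S : Subgroup G :=
    { carrier := {g | π.rep.ρ g v = v}
      one_mem' := by simp
      mul_mem' := by
        intro a b ha hb
        have ha' : π.rep.ρ a v = v := ha
        have hb' : π.rep.ρ b v = v := hb
        simp [map_mul, ha', hb']
      inv_mem' := by
        intro a ha
        have ha' : π.rep.ρ a v = v := ha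
        have h := Representation.inv_self_apply π.rep.ρ a v
        rwa [ha'] at h }
  have hSo : IsOpen (S : Set G) := π.isSmooth_rep v
  have hLo : IsOpen ((K ⊓ S : Subgroup G) : Set G) := hKo.inter hSo
  have hLc : IsCompact ((K ⊓ S : Subgroup G) : Set G) :=
    hKc.of_isClosed_subset (Subgroup.isClosed_of_isOpen _ hLo) Set.inter_subset_left
  have := (IsTame.admissible π.rep π.isSmooth_rep π.isIrreducible_rep).2 _ hLo hLc
  -- an eigenvalue on the vectors fixed by that subgroup
  let F : Representation.IntertwiningMap π.rep.ρ π.rep.ρ := Rep.Hom.hom (f : π.rep ⟶ π.rep)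
  let E : Submodule ℂ π.rep := Representation.invariants (π.rep.ρ.comp (K ⊓ S).subtype)
  have hvE : v ∈ E := fun g => g.2.2
  have hE : ∀ x ∈ E, F.toLinearMap x ∈ E := fun x hx g =>
    (Representation.IntertwiningMap.isIntertwining _ _ F g.1 x).symm.trans (congrArg F (hx g))
  have : FiniteDimensional ℂ E := this
  have : Nontrivial E := ⟨⟨v, hvE⟩, 0, fun h => hv (congrArg Subtype.val h)⟩
  obtain ⟨c, hc⟩ := Module.End.exists_eigenvalue (F.toLinearMap.restrict hE)
  obtain ⟨x, hx⟩ := hc.exists_hasEigenvector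
  refine ⟨c, ?_⟩
  have hFx : F x.1 = c • x.1 := congrArg Subtype.val hx.apply_eq_smul
  let D : End π.rep := f - algebraMap ℂ (End π.rep) c
  have hD : ∀ y, Rep.Hom.hom (D : π.rep ⟶ π.rep) y = F y - c • y := fun _ => rfl
  rcases Representation.IsIrreducible.injective_or_eq_zero (Rep.Hom.hom (D : π.rep ⟶ π.rep))
    with h | h
  · refine absurd (Subtype.ext (h ?_)) hx.2
    rw [hD, hFx, sub_self]
    exact (map_zero _).symm
  · exact (sub_eq_zero.1 (show D = 0 from Rep.hom_ext h)).symm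

/-- The isomorphism `End_G(π) ≃ ℂ`, inverse to the inclusion of the scalars. -/
def scalar [IsEllCGroup G] [IsTame G] (π : SmoothDual G) : End π.rep ≃ₐ[ℂ] ℂ :=
  (AlgEquiv.ofBijective (Algebra.ofId ℂ (End π.rep)) (schur π)).symm

/-- The action of the center of a full subcategory of the category of representations on one of
its objects. -/
def centerApp (P : ObjectProperty (Rep.{u} ℂ G)) (M : Rep.{u} ℂ G) (hM : P M) :
    CatCenter P.FullSubcategory →ₐ[ℂ] End M where
  toFun z := (z.app ⟨M, hM⟩).hom
  map_one' := rfl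
  map_mul' _ _ := rfl
  map_zero' := rfl
  map_add' _ _ := rfl
  commutes' _ := rfl

variable (G) in
/-- The Bernstein center of `G`: the `ℂ`-algebra of endomorphisms of the identity functor of the
category `R(G)` of smooth representations. -/
abbrev BernsteinCenter : Type (u + 1) := CatCenter (SmoothCat G)

/-- The Bernstein center of `R(G)_W`. -/
abbrev BernsteinCenterOn (W : Set (SmoothDual G)) : Type (u + 1) := CatCenter (SmoothCatOn W)

variable (G) in
/-- The natural map from the Bernstein center of `G` to the functions on the smooth dual: `z` goes
to the function whose value at `π` is the scalar by which `z` acts on `π`. -/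
def centerToFun [IsEllCGroup G] [IsTame G] : BernsteinCenter G →ₐ[ℂ] (SmoothDual G → ℂ) :=
  AlgHom.pi fun π => (scalar π).toAlgHom.comp (centerApp (smooth G) π.rep (smooth_rep π))

/-- The natural map from the Bernstein center of `R(G)_W` to the functions on `W`: `z` goes to the
function whose value at `π` is the scalar by which `z` acts on `π`. -/
def centerToFunOn [IsEllCGroup G] [IsTame G] (W : Set (SmoothDual G)) :
    BernsteinCenterOn W →ₐ[ℂ] (W → ℂ) :=
  AlgHom.pi fun π => (scalar π.1).toAlgHom.comp (centerApp (smoothOn W) π.1.rep (smoothOn_rep π))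

end Center

end SmoothRep

end

/-!
Smooth representations are treated as modules over the group algebra `ℂ[G]`, and the group algebra
`ℂ[K]` of a subgroup `K` as the subalgebra `levelAlgebra K`. If `K` is compact, averaging shows that
every smooth module is semisimple over `ℂ[K]` (`isSemisimpleModule_levelAlgebra`). Three facts about
a tame `ℓ_c`-group `G` carry the theorem.

*Irreducible representations are injective.* To extend a map with values in an admissible module `Q`
to one more vector `m`, an image of `m` compatible with the action of `ℂ[K]` exists for each compact
open `K` by semisimplicity. The possible images form affine subspaces of a finite-dimensional space of
fixed vectors, which decrease with `K` and hence stabilize (`exists_forall_smul_eq`,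
`IsAdmissibleModule.exists_extend`). It follows that every nonzero vector of a smooth module is
nonzero in some irreducible quotient (`exists_linearMap_mod_apply_ne_zero`), and that supports shrink
on submodules (`SupportedOn.of_injective`).

*The Fell topology is a topology of types.* For a compact open `K` and a nonzero vector `v` of `π`, let
`containing K v` be the set of `σ` which have a nonzero vector satisfying all relations of `v` over
`ℂ[K]`. These sets form a basis of neighbourhoods of `π`. They are neighbourhoods, because a
representation of `K` can be recognized from approximate matrix coefficients
(`containing_mem_nhds`). They are small, because on the finite-dimensional space of vectors of `π` fixed
by a given compact open subgroup, the image of `ℂ[G]` is the image of `ℂ[K]` for large `K`, so that one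
`K`-type determines all matrix coefficients of these vectors on `K` (`exists_containing_subset`).

*Locally constant functions act.* Let `f` be a locally constant function on `W`, and `M` a smooth module
supported on `W`. Lifting types of irreducible quotients of `M` to `M` by semisimplicity over
`ℂ[K]`, one sees that `M` is the direct sum of its largest submodules supported on the level sets of
`f` (`iSup_part_level_eq_top`, `iSupIndep_part_level`). Multiplication by `c` on the summand for the
value `c` is natural in `M`, and acts on each `π` in `W` by `f π`.

Conversely, let `z` be in the center of `R(G)_W` with `W = O ∩ C`, `O` open and `C` closed, and let
`π ∈ W`. Choose `containing K v ⊆ O` as above. The quotient of `ℂ[G]` by all relations that hold for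
those vectors of members of `W` which satisfy the relations of `v` over `ℂ[K]` is supported on `W`
(`supportedOn_quotient_relations`), so `z` maps its generator to the class of some `r`
in `ℂ[G]`. By naturality `z` acts on all the vectors in question as `r`. As `r` lies in `ℂ[K']` for
some compact open `K' ≥ K`, the action of `r` by the scalar `c` on `v` is a relation of `v` over `ℂ[K']`,
and `z` acts by `c` on all members of `W` in the neighbourhood `containing K' v` of `π`
(`isLocallyConstant_scalar_centerApp`). Finally, an element of the center of `R(G)` is determined by
its action on irreducible representations, since these separate the vectors of smooth modules
(`centerToFun_injective`).
-/

namespace SmoothRep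

open scoped MonoidAlgebra
open MonoidAlgebra (single)

/-! ### Compact open subgroups -/

section CompactOpen

variable {G : Type u} [Group G] [TopologicalSpace G]

/-- A subgroup which is both open and compact. -/
structure IsCompactOpen (K : Subgroup G) : Prop where
  isOpen : IsOpen (K : Set G)
  isCompact : IsCompact (K : Set G)

theorem IsCompactOpen.inf_of_isOpen [IsTopologicalGroup G] {K H : Subgroup G}
    (hK : IsCompactOpen K) (hH : IsOpen (H : Set G)) : IsCompactOpen (K ⊓ H) := by
  have ho : IsOpen ((K ⊓ H : Subgroup G) : Set G) := hK.isOpen.inter hH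
  exact ⟨ho, hK.isCompact.of_isClosed_subset (Subgroup.isClosed_of_isOpen _ ho)
    Set.inter_subset_left⟩

theorem exists_isCompactOpen_sup [IsEllCGroup G] {K L : Subgroup G} (hK : IsCompactOpen K)
    (hL : IsCompactOpen L) : ∃ M : Subgroup G, IsCompactOpen M ∧ K ≤ M ∧ L ≤ M := by
  obtain ⟨M, ho, hc, h⟩ := IsEllCGroup.directed K L hK.isOpen hK.isCompact hL.isOpen hL.isCompact
  exact ⟨M, ⟨ho, hc⟩, h⟩

theorem exists_isCompactOpen_subset [IsEllCGroup G] {B : Set G} (hB : IsCompact B) :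
    ∃ K : Subgroup G, IsCompactOpen K ∧ B ⊆ K := by
  have hne : Nonempty {K : Subgroup G // IsCompactOpen K} := by
    obtain ⟨K, ho, hc, -⟩ := IsEllCGroup.exists_mem (1 : G)
    exact ⟨⟨K, ho, hc⟩⟩
  obtain ⟨K, hK⟩ := hB.elim_directed_cover
    (fun K : {K : Subgroup G // IsCompactOpen K} => (K.1 : Set G)) (fun K => K.2.isOpen)
    (fun g _ => by
      obtain ⟨K, ho, hc, hg⟩ := IsEllCGroup.exists_mem g
      exact Set.mem_iUnion.2 ⟨⟨K, ho, hc⟩, hg⟩)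
    (fun K L => by
      obtain ⟨M, hM, h⟩ := exists_isCompactOpen_sup K.2 L.2
      exact ⟨⟨M, hM⟩, h⟩)
  exact ⟨K.1, K.2, hK⟩

variable (G) in
theorem exists_isCompactOpen [IsEllCGroup G] : ∃ K : Subgroup G, IsCompactOpen K :=
  (exists_isCompactOpen_subset (isCompact_empty (X := G))).imp fun _ h => h.1

end CompactOpen

/-! ### Group algebras of subgroups -/

section LevelAlgebra

variable {G : Type u} [Group G]

/-- The group algebra of a subgroup `K` of `G`, as the subalgebra of `ℂ[G]` of the elements
supported in `K`. -/
def levelAlgebra (K : Subgroup G) : Subalgebra ℂ ℂ[G] where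
  carrier := {r | ∀ g ∈ r.coeff.support, g ∈ K}
  mul_mem' {a b} ha hb g hg := by
    classical
    obtain ⟨x, hx, y, hy, rfl⟩ := Finset.mem_mul.1 (MonoidAlgebra.support_coeff_mul_subset a b hg)
    exact K.mul_mem (ha x hx) (hb y hy)
  add_mem' {a b} ha hb g hg := by
    classical
    rcases Finset.mem_union.1 (Finsupp.support_add hg) with h | h
    exacts [ha g h, hb g h]
  algebraMap_mem' c g hg := by
    have h : g ∈ (single (1 : G) c).coeff.support := hg
    rw [MonoidAlgebra.coeff_single] at h
    rw [Finset.mem_singleton.1 (Finsupp.support_single_subset h)]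
    exact K.one_mem

theorem levelAlgebra_mono {K L : Subgroup G} (h : K ≤ L) : levelAlgebra K ≤ levelAlgebra L :=
  fun _ hr g hg => h (hr g hg)

theorem single_mem_levelAlgebra {K : Subgroup G} {g : G} (hg : g ∈ K) (c : ℂ) :
    single g c ∈ levelAlgebra K := fun x hx => by
  rw [MonoidAlgebra.coeff_single] at hx
  rwa [Finset.mem_singleton.1 (Finsupp.support_single_subset hx)]

theorem exists_mem_levelAlgebra [TopologicalSpace G] [IsEllCGroup G] (r : ℂ[G]) :
    ∃ K : Subgroup G, IsCompactOpen K ∧ r ∈ levelAlgebra K :=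
  exists_isCompactOpen_subset r.coeff.support.finite_toSet.isCompact

/-- The inclusion of a subgroup in its group algebra. -/
noncomputable def levelOf (K : Subgroup G) : K →* levelAlgebra K where
  toFun k := ⟨single k.1 1, single_mem_levelAlgebra k.2 1⟩
  map_one' := rfl
  map_mul' a b := Subtype.ext (by simp [MonoidAlgebra.single_mul_single])

theorem levelOf_smul {K : Subgroup G} {M : Type*} [AddCommGroup M] [Module ℂ[G] M] (k : K)
    (m : M) : levelOf K k • m = single (k : G) (1 : ℂ) • m := rfl

theorem smul_eq_sum {M : Type*} [AddCommGroup M] [Module ℂ[G] M] [Module ℂ M]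
    [IsScalarTower ℂ ℂ[G] M] (r : ℂ[G]) (m : M) :
    r • m = ∑ g ∈ r.coeff.support, r.coeff g • (single g (1 : ℂ) • m) := by
  conv_lhs => rw [← MonoidAlgebra.sum_coeff_single r, Finsupp.sum, Finset.sum_smul]
  refine Finset.sum_congr rfl fun g _ => ?_
  rw [← smul_assoc, MonoidAlgebra.smul_single', mul_one]

theorem levelAlgebra_induction {K : Subgroup G} {p : levelAlgebra K → Prop}
    (h0 : p 0) (hadd : ∀ a b, p a → p b → p (a + b)) (hsmul : ∀ (c : ℂ) k, p (c • levelOf K k))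
    (r : levelAlgebra K) : p r := by
  have key : r = ∑ g ∈ r.1.coeff.support.attach, r.1.coeff g.1 • levelOf K ⟨g.1, r.2 g.1 g.2⟩ := by
    apply Subtype.ext
    rw [AddSubmonoidClass.coe_finsetSum]
    conv_lhs => rw [← MonoidAlgebra.sum_coeff_single r.1, Finsupp.sum, ← Finset.sum_attach]
    refine Finset.sum_congr rfl fun g _ => ?_
    change _ = r.1.coeff g.1 • single g.1 (1 : ℂ)
    rw [MonoidAlgebra.smul_single', mul_one]
  rw [key]
  exact Finset.sum_induction _ p hadd h0 fun g _ => hsmul _ _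

/-- A `ℂ`-linear map commuting with the action of `K` is linear over the group algebra of `K`. -/
def linearOfEquivariant {K : Subgroup G} {M N : Type*} [AddCommMonoid M] [AddCommMonoid N]
    [Module (levelAlgebra K) M] [Module (levelAlgebra K) N] [Module ℂ M] [Module ℂ N]
    [IsScalarTower ℂ (levelAlgebra K) M] [IsScalarTower ℂ (levelAlgebra K) N] (f : M →ₗ[ℂ] N)
    (hf : ∀ k m, f (levelOf K k • m) = levelOf K k • f m) : M →ₗ[levelAlgebra K] N where
  toFun := f
  map_add' := f.map_add
  map_smul' r m := by
    induction r using levelAlgebra_induction with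
    | h0 => simp
    | hadd a b ha hb => simp only [RingHom.id_apply] at *; rw [add_smul, add_smul, map_add, ha, hb]
    | hsmul c k => simp only [RingHom.id_apply]; rw [smul_assoc, smul_assoc, map_smul, hf]

end LevelAlgebra

/-! ### Smooth modules are semisimple over compact groups -/

section Smooth

variable {G : Type u} [Group G]

section stab

variable (G) {M : Type*} [AddCommGroup M] [Module ℂ[G] M]

/-- The stabilizer of an element of a `ℂ[G]`-module. -/
def stab (m : M) : Subgroup G where
  carrier := {g | single g (1 : ℂ) • m = m}
  one_mem' := by
    change (1 : ℂ[G]) • m = m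
    simp
  mul_mem' {a b} ha hb := by
    change single (a * b) (1 : ℂ) • m = m
    rw [show single (a * b) (1 : ℂ) = single a 1 * single b 1 by
      simp [MonoidAlgebra.single_mul_single], mul_smul, hb, ha]
  inv_mem' {a} ha := by
    change single a⁻¹ (1 : ℂ) • m = m
    have h : single a⁻¹ (1 : ℂ) • single a (1 : ℂ) • m = m := by
      rw [← mul_smul, MonoidAlgebra.single_mul_single, inv_mul_cancel, mul_one]
      exact one_smul ℂ[G] m
    rwa [show single a (1 : ℂ) • m = m from ha] at h

variable {G}

theorem mem_stab {m : M} {g : G} : g ∈ stab G m ↔ single g (1 : ℂ) • m = m := Iff.rfl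

theorem single_mul_smul (a b : G) (m : M) :
    single (a * b) (1 : ℂ) • m = single a (1 : ℂ) • single b (1 : ℂ) • m := by
  rw [← mul_smul, MonoidAlgebra.single_mul_single, mul_one]

theorem stab_le_map {N : Type*} [AddCommGroup N] [Module ℂ[G] N] (f : M →ₗ[ℂ[G]] N) (m : M) :
    stab G m ≤ stab G (f m) := fun g hg => by
  rw [mem_stab, ← map_smul, mem_stab.1 hg]

theorem single_sub_one_smul_eq_zero {m : M} {g : G} :
    (single g (1 : ℂ) - 1 : ℂ[G]) • m = 0 ↔ g ∈ stab G m := by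
  rw [sub_smul, one_smul, sub_eq_zero, mem_stab]

/-- The fixed vectors of a subgroup, as a complex vector space. -/
def fixed [Module ℂ M] [IsScalarTower ℂ ℂ[G] M] (L : Subgroup G) : Submodule ℂ M where
  carrier := {m | L ≤ stab G m}
  add_mem' {a b} ha hb g hg := by
    rw [mem_stab, smul_add, mem_stab.1 (ha hg), mem_stab.1 (hb hg)]
  zero_mem' g _ := by rw [mem_stab, smul_zero]
  smul_mem' c m hm g hg := by
    have : SMulCommClass ℂ[G] ℂ M := IsScalarTower.to_smulCommClass'
    rw [mem_stab, smul_comm, mem_stab.1 (hm hg)]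

end stab

variable [TopologicalSpace G]

/-- A `ℂ[G]`-module is smooth if all stabilizers are open. -/
class IsSmoothModule (G : Type u) [Group G] [TopologicalSpace G] (M : Type*) [AddCommGroup M]
    [Module ℂ[G] M] : Prop where
  isOpen_stab : ∀ m : M, IsOpen (stab G m : Set G)

section

variable {M N : Type*} [AddCommGroup M] [Module ℂ[G] M] [AddCommGroup N] [Module ℂ[G] N]

theorem IsSmoothModule.of_injective [IsSmoothModule G M] (f : N →ₗ[ℂ[G]] M)
    (hf : Function.Injective f) : IsSmoothModule G N where
  isOpen_stab n := by
    have h : stab G n = stab G (f n) := by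
      ext g
      rw [mem_stab, mem_stab, ← map_smul, hf.eq_iff]
    rw [h]
    exact IsSmoothModule.isOpen_stab _

instance [IsSmoothModule G M] (P : Submodule ℂ[G] M) : IsSmoothModule G P :=
  .of_injective P.subtype P.subtype_injective

variable [IsTopologicalGroup G]

theorem IsSmoothModule.of_surjective [IsSmoothModule G M] (f : M →ₗ[ℂ[G]] N)
    (hf : Function.Surjective f) : IsSmoothModule G N where
  isOpen_stab n := by
    obtain ⟨m, rfl⟩ := hf n
    exact Subgroup.isOpen_mono (stab_le_map f m) (IsSmoothModule.isOpen_stab m)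

instance [IsSmoothModule G M] (P : Submodule ℂ[G] M) : IsSmoothModule G (M ⧸ P) :=
  .of_surjective P.mkQ P.mkQ_surjective

/-- A cyclic module is smooth as soon as its generator is. -/
theorem IsSmoothModule.of_span_eq_top (m : M) (hm : IsOpen (stab G m : Set G))
    [Module ℂ M] [IsScalarTower ℂ ℂ[G] M]
    (hspan : Submodule.span ℂ[G] {m} = ⊤) : IsSmoothModule G M where
  isOpen_stab x := by
    obtain ⟨r, rfl⟩ := Submodule.mem_span_singleton.1 (hspan ▸ Submodule.mem_top : x ∈ _)
    have : SMulCommClass ℂ[G] ℂ M := IsScalarTower.to_smulCommClass'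
    -- the stabilizer of `r • m` contains the conjugates of that of `m` by the support of `r`
    refine Subgroup.isOpen_mono (H₁ := ⨅ g : r.coeff.support,
      (stab G m).map (MulAut.conj g.1).toMonoidHom) (fun h hh => ?_) ?_
    · rw [mem_stab, smul_eq_sum r m, Finset.smul_sum]
      refine Finset.sum_congr rfl fun g hg => ?_
      rw [smul_comm]
      congr 1
      obtain ⟨k, hk, rfl⟩ := Subgroup.mem_map.1 (Subgroup.mem_iInf.1 hh ⟨g, hg⟩)
      rw [← single_mul_smul]
      simp only [MulEquiv.toMonoidHom_eq_coe, MonoidHom.coe_coe, MulAut.conj_apply,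
        inv_mul_cancel_right]
      rw [single_mul_smul, mem_stab.1 hk]
    · rw [Subgroup.coe_iInf]
      refine isOpen_iInter_of_finite fun g => ?_
      have : (((stab G m).map (MulAut.conj g.1).toMonoidHom : Subgroup G) : Set G) =
          (fun x => g.1⁻¹ * x * g.1) ⁻¹' (stab G m : Set G) := by
        ext x
        constructor
        · rintro ⟨k, hk, rfl⟩
          simpa [mul_assoc] using hk
        · intro hx
          exact ⟨_, hx, by simp [mul_assoc]⟩
      rw [this]
      exact hm.preimage (by fun_prop)

end

/-- Averaging over a compact group: a representation of `K` which is trivial on an open subgroup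
is semisimple. -/
theorem isSemisimpleModule_of_trivial [IsTopologicalGroup G] {K H : Subgroup G}
    (hK : IsCompact (K : Set G)) (hH : IsOpen (H : Set G)) {T : Type*} [AddCommGroup T]
    [Module (levelAlgebra K) T] [Module ℂ T] [IsScalarTower ℂ (levelAlgebra K) T]
    (htriv : ∀ k : K, k.1 ∈ H → ∀ t : T, levelOf K k • t = t) :
    IsSemisimpleModule (levelAlgebra K) T := by
  have : SMulCommClass (levelAlgebra K) ℂ T := IsScalarTower.to_smulCommClass'
  have : CompactSpace K := isCompact_iff_compactSpace.1 hK
  have hfin : Finite (K ⧸ H.subgroupOf K) :=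
    Subgroup.quotient_finite_of_isOpen _ (Subgroup.subgroupOf_isOpen K H hH)
  have := Fintype.ofFinite (K ⧸ H.subgroupOf K)
  refine @IsSemisimpleModule.mk _ _ _ _ _ ⟨fun N => ?_⟩
  obtain ⟨p, hpN⟩ : ∃ p : T →ₗ[ℂ] N, ∀ n : N, p (n : T) = n := by
    obtain ⟨p, hp⟩ := (N.restrictScalars ℂ).subtype.exists_leftInverse_of_injective
      (LinearMap.ker_eq_bot.2 (N.restrictScalars ℂ).subtype_injective)
    exact ⟨p, fun n => LinearMap.congr_fun hp n⟩
  -- conjugates of the projection, indexed by cosets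
  let φ : K → (T →ₗ[ℂ] N) := fun k =>
    (Module.toModuleEnd ℂ N (levelOf K k)).comp
      (p.comp (Module.toModuleEnd ℂ T (levelOf K k⁻¹)))
  have hφ : ∀ k t, φ k t = levelOf K k • p (levelOf K k⁻¹ • t) := fun _ _ => rfl
  have hcoset : ∀ k h : K, h.1 ∈ H → φ (k * h) = φ k := fun k h hh => by
    ext1 t
    rw [hφ, hφ, mul_inv_rev, map_mul, map_mul, mul_smul, mul_smul,
      htriv h⁻¹ (H.inv_mem hh)]
    congr 1
    exact Subtype.ext (htriv h hh _)
  have hout : ∀ k : K, φ ((k : K ⧸ H.subgroupOf K).out) = φ k := fun k => by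
    obtain ⟨h, hh⟩ := QuotientGroup.mk_out_eq_mul (H.subgroupOf K) k
    rw [hh]
    exact hcoset _ _ h.2
  have hcard : (Fintype.card (K ⧸ H.subgroupOf K) : ℂ) ≠ 0 :=
    Nat.cast_ne_zero.2 Fintype.card_ne_zero
  let q₀ : T →ₗ[ℂ] N := (Fintype.card (K ⧸ H.subgroupOf K) : ℂ)⁻¹ •
    ∑ c : K ⧸ H.subgroupOf K, φ c.out
  have hq₀ : ∀ t, q₀ t = (Fintype.card (K ⧸ H.subgroupOf K) : ℂ)⁻¹ •
      ∑ c : K ⧸ H.subgroupOf K, φ c.out t := fun t => by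
    simp [q₀]
  have hequiv : ∀ (k : K) (t : T), q₀ (levelOf K k • t) = levelOf K k • q₀ t := fun k t => by
    rw [hq₀, hq₀, smul_comm (levelOf K k)]
    congr 1
    rw [Finset.smul_sum, ← Equiv.sum_comp (MulAction.toPerm k)]
    refine Finset.sum_congr rfl fun c _ => ?_
    induction c using QuotientGroup.induction_on with
    | H x =>
      have hkx : (MulAction.toPerm k) (x : K ⧸ H.subgroupOf K) =
        ((k * x : K) : K ⧸ H.subgroupOf K) := rfl
      rw [hkx, hout, hout, hφ, hφ, mul_inv_rev, ← mul_smul, ← mul_smul, ← map_mul, ← map_mul,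
        inv_mul_cancel_right]
  let q : T →ₗ[levelAlgebra K] N := linearOfEquivariant q₀ hequiv
  have hq : ∀ n : N, q (n : T) = n := fun n => by
    change q₀ n = n
    rw [hq₀]
    have : ∀ c : K ⧸ H.subgroupOf K, φ c.out (n : T) = n := fun c => by
      rw [hφ]
      have h := hpN (levelOf K c.out⁻¹ • n)
      rw [show levelOf K c.out⁻¹ • (n : T) = ((levelOf K c.out⁻¹ • n : N) : T) from rfl, h,
        ← mul_smul, ← map_mul, mul_inv_cancel, map_one, one_smul]
    simp only [this, Finset.sum_const, Finset.card_univ]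
    rw [← Nat.cast_smul_eq_nsmul ℂ, smul_smul, inv_mul_cancel₀ hcard, one_smul]
  exact ⟨LinearMap.ker q, LinearMap.isCompl_of_proj hq⟩

section

variable [IsTopologicalGroup G] {M : Type*} [AddCommGroup M] [Module ℂ[G] M]
  [IsSmoothModule G M] {K : Subgroup G}

/-- The orbit of a smooth vector under a compact group is finite, hence fixed pointwise by some open
subgroup. -/
theorem exists_isOpen_forall_smul_eq (hK : IsCompact (K : Set G)) (m : M) :
    ∃ H : Subgroup G, IsOpen (H : Set G) ∧
      ∀ h ∈ H, ∀ k ∈ K, single h (1 : ℂ) • single k (1 : ℂ) • m = single k (1 : ℂ) • m := by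
  have hcov : (K : Set G) ⊆ ⋃ k : G, (fun x => k⁻¹ * x) ⁻¹' (stab G m : Set G) := fun k _ =>
    Set.mem_iUnion.2 ⟨k, by simp [(stab G m).one_mem]⟩
  obtain ⟨t, ht⟩ := hK.elim_finite_subcover _
    (fun k => (IsSmoothModule.isOpen_stab m).preimage (by fun_prop)) hcov
  refine ⟨⨅ k : t, stab G (single k.1 (1 : ℂ) • m), ?_, fun h hh k hk => ?_⟩
  · rw [Subgroup.coe_iInf]
    exact isOpen_iInter_of_finite fun k => IsSmoothModule.isOpen_stab _
  · obtain ⟨x, hx, hkx⟩ := Set.mem_iUnion₂.1 (ht hk)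
    have h1 : single k (1 : ℂ) • m = single x (1 : ℂ) • m := by
      rw [← mul_inv_cancel_left x k, single_mul_smul, mem_stab.1 hkx]
    rw [h1]
    exact Subgroup.mem_iInf.1 hh ⟨x, hx⟩

/-- Smooth modules are semisimple under compact subgroups. -/
theorem isSemisimpleModule_levelAlgebra [Module ℂ M] [IsScalarTower ℂ ℂ[G] M]
    (hK : IsCompact (K : Set G)) :
    IsSemisimpleModule (levelAlgebra K) M := by
  refine isSemisimpleModule_of_isSemisimpleModule_submodule'
    (p := fun m : M => Submodule.span (levelAlgebra K) {m}) (fun m => ?_) ?_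
  · obtain ⟨H, hH, hfix⟩ := exists_isOpen_forall_smul_eq hK m
    refine isSemisimpleModule_of_trivial hK hH fun h hh t => Subtype.ext ?_
    obtain ⟨r, hr⟩ := Submodule.mem_span_singleton.1 t.2
    change levelOf K h • (t : M) = t
    rw [← hr]
    have : SMulCommClass (levelAlgebra K) ℂ M := IsScalarTower.to_smulCommClass'
    induction r using levelAlgebra_induction generalizing t with
    | h0 => simp
    | hadd a b ha hb =>
      rw [add_smul, smul_add, ha ⟨a • m, Submodule.mem_span_singleton.2 ⟨a, rfl⟩⟩ rfl,
        hb ⟨b • m, Submodule.mem_span_singleton.2 ⟨b, rfl⟩⟩ rfl]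
    | hsmul c k =>
      rw [smul_assoc, smul_comm]
      congr 1
      exact hfix h hh k k.2
  · rw [eq_top_iff]
    exact fun m _ => Submodule.mem_iSup_of_mem m (Submodule.mem_span_singleton_self m)

/-- Elements can be lifted along maps out of a semisimple module without shrinking the
annihilator. -/
theorem exists_lift_of_isSemisimpleModule {A M Q : Type*} [Ring A] [AddCommGroup M] [Module A M]
    [AddCommGroup Q] [Module A Q] [IsSemisimpleModule A M] (f : M →ₗ[A] Q) (m : M) :
    ∃ x, f x = f m ∧ ∀ s : A, s • f m = 0 → s • x = 0 := by
  obtain ⟨C, hC⟩ := exists_isCompl (LinearMap.ker f)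
  obtain ⟨y, hy, x, hx, hyx⟩ := Submodule.mem_sup.1
    (hC.sup_eq_top ▸ Submodule.mem_top : m ∈ LinearMap.ker f ⊔ C)
  have hfx : f x = f m := by rw [← hyx, map_add, LinearMap.mem_ker.1 hy, zero_add]
  refine ⟨x, hfx, fun s hs => ?_⟩
  refine Submodule.disjoint_def.1 hC.disjoint _ ?_ (C.smul_mem s hx)
  rw [LinearMap.mem_ker, map_smul, hfx, hs]

/-- A linear map on a submodule of a semisimple module extends. -/
theorem exists_extend_of_isSemisimpleModule {A M Q : Type*} [Ring A] [AddCommGroup M] [Module A M]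
    [AddCommGroup Q] [Module A Q] [IsSemisimpleModule A M] {N : Submodule A M} (f : N →ₗ[A] Q) :
    ∃ g : M →ₗ[A] Q, ∀ n : N, g n = f n := by
  obtain ⟨g, hg⟩ := IsSemisimpleModule.extension_property N.subtype N.subtype_injective f
  exact ⟨g, fun n => LinearMap.congr_fun hg n⟩

/-- A cyclic module maps to any element with a larger annihilator. -/
theorem exists_linearMap_span_singleton {A M Q : Type*} [Ring A] [AddCommGroup M] [Module A M]
    [AddCommGroup Q] [Module A Q] (m : M) (x : Q) (h : ∀ s : A, s • m = 0 → s • x = 0) :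
    ∃ f : Submodule.span A {m} →ₗ[A] Q, ∀ s : A,
      f ⟨s • m, Submodule.mem_span_singleton.2 ⟨s, rfl⟩⟩ = s • x := by
  let e := LinearMap.quotKerEquivRange (LinearMap.toSpanSingleton A M m)
  let g : (A ⧸ LinearMap.ker (LinearMap.toSpanSingleton A M m)) →ₗ[A] Q :=
    Submodule.liftQ _ (LinearMap.toSpanSingleton A Q x) fun s hs => by
      simpa using h s (by simpa using hs)
  let i : Submodule.span A {m} →ₗ[A] LinearMap.range (LinearMap.toSpanSingleton A M m) :=
    Submodule.inclusion (LinearMap.span_singleton_eq_range A M m).le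
  refine ⟨g ∘ₗ e.symm.toLinearMap ∘ₗ i, fun s => ?_⟩
  have h1 : i ⟨s • m, Submodule.mem_span_singleton.2 ⟨s, rfl⟩⟩ = e (Submodule.Quotient.mk s) :=
    Subtype.ext rfl
  change g (e.symm (i _)) = _
  rw [h1, e.symm_apply_apply]
  simp [g]

end

end Smooth

/-! ### Admissible modules are injective -/

section Injective

variable {G : Type u} [Group G] [TopologicalSpace G]

/-- A `ℂ[G]`-module in which the vectors fixed by any compact open subgroup form a
finite-dimensional space. -/
def IsAdmissibleModule (G : Type u) [Group G] [TopologicalSpace G] (Q : Type*) [AddCommGroup Q]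
    [Module ℂ[G] Q] [Module ℂ Q] [IsScalarTower ℂ ℂ[G] Q] : Prop :=
  ∀ L : Subgroup G, IsCompactOpen L → FiniteDimensional ℂ (fixed L : Submodule ℂ Q)

variable [IsEllCGroup G] {M Q : Type*} [AddCommGroup M] [Module ℂ[G] M] [IsSmoothModule G M]

/-- Every smooth vector is fixed by a compact open subgroup. -/
theorem exists_isCompactOpen_le_stab (m : M) : ∃ L : Subgroup G, IsCompactOpen L ∧ L ≤ stab G m := by
  obtain ⟨K, hK⟩ := exists_isCompactOpen G
  exact ⟨K ⊓ stab G m, hK.inf_of_isOpen (IsSmoothModule.isOpen_stab m), inf_le_right⟩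

variable [Module ℂ M] [IsScalarTower ℂ ℂ[G] M]
  [AddCommGroup Q] [Module ℂ[G] Q] [Module ℂ Q] [IsScalarTower ℂ ℂ[G] Q]

/-- A map to an admissible module extends to one more vector. The possible images of `m` compatible
with the action of `ℂ[K]` form a nonempty affine subspace of a finite-dimensional space which
decreases with `K`, so it is eventually constant. -/
theorem exists_forall_smul_eq (hQ : IsAdmissibleModule G Q) {N : Submodule ℂ[G] M}
    (φ : N →ₗ[ℂ[G]] Q) (m : M) :
    ∃ y : Q, ∀ (r : ℂ[G]) (h : r • m ∈ N), φ ⟨r • m, h⟩ = r • y := by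
  obtain ⟨L, hL, hLm⟩ := exists_isCompactOpen_le_stab (G := G) m
  have := hQ L hL
  have hcomm : SMulCommClass ℂ[G] ℂ Q := IsScalarTower.to_smulCommClass'
  -- the differences of possible images of `m` at level `K`
  let V : Subgroup G → Submodule ℂ Q := fun K =>
    { carrier := {y | y ∈ (fixed L : Submodule ℂ Q) ∧
        ∀ r ∈ levelAlgebra K, r • m ∈ N → r • y = 0}
      add_mem' := fun ⟨ha, ha'⟩ ⟨hb, hb'⟩ => ⟨add_mem ha hb, fun r hr h => by
        rw [smul_add, ha' r hr h, hb' r hr h, add_zero]⟩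
      zero_mem' := ⟨zero_mem _, fun r _ _ => smul_zero r⟩
      smul_mem' := fun c y ⟨hy, hy'⟩ => ⟨Submodule.smul_mem _ c hy, fun r hr h => by
        rw [smul_comm, hy' r hr h, smul_zero]⟩ }
  have hVfix : ∀ K, V K ≤ fixed L := fun K y hy => hy.1
  have hVfin : ∀ K, FiniteDimensional ℂ (V K) := fun K =>
    Submodule.finiteDimensional_of_le (hVfix K)
  have hVanti : ∀ {K K'}, K ≤ K' → V K' ≤ V K := fun h y hy =>
    ⟨hy.1, fun r hr => hy.2 r (levelAlgebra_mono h hr)⟩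
  -- solutions for a fixed level exist by semisimplicity
  have hY : ∀ K, IsCompactOpen K → L ≤ K → ∃ y ∈ (fixed L : Submodule ℂ Q),
      ∀ r ∈ levelAlgebra K, ∀ h : r • m ∈ N, φ ⟨r • m, h⟩ = r • y := by
    intro K hK hLK
    have : IsSemisimpleModule (levelAlgebra K) M := isSemisimpleModule_levelAlgebra hK.isCompact
    let φK : N.restrictScalars (levelAlgebra K) →ₗ[levelAlgebra K] Q :=
      { toFun := φ
        map_add' := φ.map_add
        map_smul' := fun r x => φ.map_smul r.1 x }
    obtain ⟨g, hg⟩ := exists_extend_of_isSemisimpleModule φK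
    refine ⟨g m, fun l hl => ?_, fun r hr h => ?_⟩
    · have h1 := g.map_smul (levelOf K ⟨l, hLK hl⟩) m
      rw [levelOf_smul, levelOf_smul, mem_stab.1 (hLm hl)] at h1
      exact h1.symm
    · have h1 := g.map_smul ⟨r, hr⟩ m
      exact (hg ⟨r • m, h⟩).symm.trans h1
  obtain ⟨K₁, hK₁⟩ := exists_isCompactOpen G
  obtain ⟨K₂, hK₂, hLK₂, -⟩ := exists_isCompactOpen_sup hL hK₁
  obtain ⟨K₀, ⟨hK₀, hLK₀⟩, hmin⟩ := WellFounded.has_min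
    (measure fun K : Subgroup G => Module.finrank ℂ (V K)).wf
    {K | IsCompactOpen K ∧ L ≤ K} ⟨K₂, hK₂, hLK₂⟩
  have hVeq : ∀ K, IsCompactOpen K → K₀ ≤ K → V K = V K₀ := fun K hK h =>
    Submodule.eq_of_le_of_finrank_le (hVanti h) (not_lt.1 (hmin K ⟨hK, hLK₀.trans h⟩))
  obtain ⟨y, hyfix, hy⟩ := hY K₀ hK₀ hLK₀
  refine ⟨y, fun r h => ?_⟩
  obtain ⟨K₃, hK₃, hr⟩ := exists_mem_levelAlgebra r
  obtain ⟨K, hK, h₀, h₃⟩ := exists_isCompactOpen_sup hK₀ hK₃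
  obtain ⟨z, hzfix, hz⟩ := hY K hK (hLK₀.trans h₀)
  have hzy : z - y ∈ V K := by
    rw [hVeq K hK h₀]
    refine ⟨sub_mem hzfix hyfix, fun s hs hsm => ?_⟩
    rw [smul_sub, ← hz s (levelAlgebra_mono h₀ hs) hsm, ← hy s hs hsm, sub_self]
  have h1 := hzy.2 r (levelAlgebra_mono h₃ hr) h
  rw [smul_sub, sub_eq_zero] at h1
  rw [hz r (levelAlgebra_mono h₃ hr) h, h1]

/-- Admissible modules are injective in the category of smooth modules. -/
theorem IsAdmissibleModule.exists_extend (hQ : IsAdmissibleModule G Q) {N : Submodule ℂ[G] M}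
    (φ : N →ₗ[ℂ[G]] Q) : ∃ ψ : M →ₗ[ℂ[G]] Q, ∀ n : N, ψ n = φ n := by
  have : Fact (Function.Injective N.subtype) := ⟨N.subtype_injective⟩
  -- a maximal extension of `φ` is defined everywhere, since it extends to one more vector
  let E := Module.Baer.extensionOfMax N.subtype φ
  have htop : E.domain = ⊤ := by
    rw [Submodule.eq_top_iff']
    intro m
    obtain ⟨y, hy⟩ := exists_forall_smul_eq hQ E.toLinearPMap.toFun m
    have h0 : ∀ r : ℂ[G], r • m = 0 → r • y = 0 := fun r hr => by
      rw [← hy r (hr ▸ zero_mem _)]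
      have : (⟨r • m, hr ▸ zero_mem _⟩ : E.domain) = 0 := Subtype.ext hr
      rw [this, map_zero]
    let g : M →ₗ.[ℂ[G]] Q := LinearPMap.mkSpanSingleton' (σ := RingHom.id ℂ[G]) m y h0
    have hcompat : ∀ (x : E.domain) (z : g.domain), (x : M) = z → E.toLinearPMap x = g z := by
      rintro ⟨x, hx⟩ ⟨z, hz⟩ (rfl : x = z)
      obtain ⟨r, rfl⟩ := Submodule.mem_span_singleton.1 hz
      exact (hy r hx).trans (LinearPMap.mkSpanSingleton'_apply m y h0 r hz).symm
    let E' : Module.Baer.ExtensionOf N.subtype φ :=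
      { E.toLinearPMap.sup _ hcompat with
        le := E.le.trans (LinearPMap.left_le_sup _ _ hcompat).1
        is_extension := fun n => (E.is_extension n).trans
          ((LinearPMap.left_le_sup _ _ hcompat).2 (x := ⟨_, _⟩) (y := ⟨_, _⟩) rfl) }
    have hE : E' = E := Module.Baer.extensionOfMax_is_max _ _ E' (LinearPMap.left_le_sup _ _ hcompat)
    rw [← hE]
    exact (LinearPMap.right_le_sup _ _ hcompat).1 (Submodule.mem_span_singleton_self m)
  refine ⟨E.toLinearPMap.toFun ∘ₗ (LinearEquiv.ofTop _ htop).symm.toLinearMap, fun n => ?_⟩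
  exact (E.is_extension n).symm

end Injective

/-! ### Large compact subgroups act irreducibly on fixed vectors -/

section Irreducible

variable {G : Type u} [Group G] [TopologicalSpace G] [IsTopologicalGroup G]
  {M : Type*} [AddCommGroup M] [Module ℂ[G] M] [IsSmoothModule G M]

/-- The sum over a suitable finite subset of a compact group `L` maps finitely many given vectors to
vectors fixed by `L`. -/
theorem exists_finset_sum_smul_mem_fixed {L : Subgroup G} (hL : IsCompact (L : Set G))
    {ι : Type*} [Finite ι] (v : ι → M) :
    ∃ s : Finset G, s.Nonempty ∧ (∀ l ∈ s, l ∈ L) ∧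
      ∀ i, L ≤ stab G (∑ l ∈ s, single l (1 : ℂ) • v i) := by
  classical
  let H : Subgroup G := ⨅ i, stab G (v i)
  have hH : IsOpen (H : Set G) := by
    rw [Subgroup.coe_iInf]
    exact isOpen_iInter_of_finite fun i => IsSmoothModule.isOpen_stab _
  have : CompactSpace L := isCompact_iff_compactSpace.1 hL
  have hfin : Finite (L ⧸ H.subgroupOf L) :=
    Subgroup.quotient_finite_of_isOpen _ (Subgroup.subgroupOf_isOpen L H hH)
  have := Fintype.ofFinite (L ⧸ H.subgroupOf L)
  have hinj : Function.Injective fun c : L ⧸ H.subgroupOf L => (c.out : G) := fun a b h => by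
    rw [← Quotient.out_eq' a, ← Quotient.out_eq' b]
    exact congrArg _ (Subtype.ext h)
  have hout : ∀ (i : ι) (l : L), single ((l : L ⧸ H.subgroupOf L).out : G) (1 : ℂ) • v i =
      single (l : G) (1 : ℂ) • v i := fun i l => by
    obtain ⟨h, hh⟩ := QuotientGroup.mk_out_eq_mul (H.subgroupOf L) l
    rw [hh, Subgroup.coe_mul, single_mul_smul]
    congr 1
    exact Subgroup.mem_iInf.1 h.2 i
  refine ⟨Finset.univ.map ⟨_, hinj⟩, ?_, ?_, ?_⟩
  · exact Finset.univ_nonempty.map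
  · intro l hl
    obtain ⟨c, -, rfl⟩ := Finset.mem_map.1 hl
    exact c.out.2
  · intro i l hl
    rw [mem_stab, Finset.sum_map, Finset.smul_sum, ← Equiv.sum_comp (MulAction.toPerm (⟨l, hl⟩ : L))
      fun c : L ⧸ H.subgroupOf L => single ((⟨_, hinj⟩ : _ ↪ G) c) (1 : ℂ) • v i]
    refine Finset.sum_congr rfl fun c _ => ?_
    induction c using QuotientGroup.induction_on with
    | H x =>
      have hlx : (MulAction.toPerm (⟨l, hl⟩ : L)) (x : L ⧸ H.subgroupOf L) =
        (((⟨l, hl⟩ : L) * x : L) : L ⧸ H.subgroupOf L) := rfl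
      rw [hlx]
      change _ • single ((x : L ⧸ H.subgroupOf L).out : G) (1 : ℂ) • v i =
        single (((⟨l, hl⟩ * x : L) : L ⧸ H.subgroupOf L).out : G) (1 : ℂ) • v i
      rw [hout, hout, Subgroup.coe_mul, single_mul_smul]

variable [Module ℂ M] [IsScalarTower ℂ ℂ[G] M]

/-- The averaging idempotent: an element of the group algebra of the compact group `L` which maps
finitely many given vectors to vectors fixed by `L`, and fixes all vectors fixed by `L`. -/
theorem exists_average {L : Subgroup G} (hL : IsCompact (L : Set G)) {ι : Type*} [Finite ι]
    (v : ι → M) : ∃ e ∈ levelAlgebra L, (∀ i, e • v i ∈ (fixed L : Submodule ℂ M)) ∧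
      ∀ x ∈ (fixed L : Submodule ℂ M), e • x = x := by
  obtain ⟨s, hs, hsL, hfix⟩ := exists_finset_sum_smul_mem_fixed hL v
  have hcard : (s.card : ℂ) ≠ 0 := Nat.cast_ne_zero.2 hs.card_pos.ne'
  refine ⟨(s.card : ℂ)⁻¹ • ∑ l ∈ s, single l (1 : ℂ), ?_, fun i => ?_, fun x hx => ?_⟩
  · exact Subalgebra.smul_mem _ (Subalgebra.sum_mem _ fun l hl =>
      single_mem_levelAlgebra (hsL l hl) 1) _
  · rw [smul_assoc, Finset.sum_smul]
    exact Submodule.smul_mem _ _ (hfix i)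
  · rw [smul_assoc, Finset.sum_smul, Finset.sum_congr rfl fun l hl => mem_stab.1 (hx (hsL l hl)),
      Finset.sum_const, ← Nat.cast_smul_eq_nsmul ℂ, smul_smul, inv_mul_cancel₀ hcard, one_smul]

end Irreducible

section Irreducible

variable {G : Type u} [Group G] [TopologicalSpace G] [IsEllCGroup G]
  {M : Type*} [AddCommGroup M] [Module ℂ[G] M] [IsSmoothModule G M]
  [Module ℂ M] [IsScalarTower ℂ ℂ[G] M]

/-- The endomorphisms of the fixed vectors of `L` in an irreducible admissible module which are
given by elements of `ℂ[K]` do not depend on `K` once `K` is large, so the group algebra of one `K`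
already acts transitively on nonzero fixed vectors. -/
theorem exists_isCompactOpen_forall_exists_smul_eq [IsSimpleModule ℂ[G] M]
    (hM : IsAdmissibleModule G M) {L K₀ : Subgroup G} (hL : IsCompactOpen L)
    (hK₀ : IsCompactOpen K₀) :
    ∃ K, IsCompactOpen K ∧ K₀ ≤ K ∧ L ≤ K ∧ ∀ x ∈ (fixed L : Submodule ℂ M), x ≠ 0 →
      ∀ y ∈ (fixed L : Submodule ℂ M), ∃ s ∈ levelAlgebra K, s • x = y := by
  have hfin := hM L hL
  let X : Submodule ℂ M := fixed L
  -- the endomorphisms of the fixed vectors given by elements of `ℂ[K]`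
  let B : Subgroup G → Submodule ℂ (X →ₗ[ℂ] X) := fun K =>
    { carrier := {T | ∃ r ∈ levelAlgebra K, ∀ x : X, (T x : M) = r • (x : M)}
      add_mem' := fun ⟨r, hr, h⟩ ⟨r', hr', h'⟩ => ⟨r + r', add_mem hr hr', fun x => by
        rw [add_smul, ← h, ← h']; rfl⟩
      zero_mem' := ⟨0, zero_mem _, fun x => by rw [zero_smul]; rfl⟩
      smul_mem' := fun c T ⟨r, hr, h⟩ => ⟨c • r, Subalgebra.smul_mem _ hr c, fun x => by
        rw [smul_assoc, ← h]; rfl⟩ }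
  have hBmono : ∀ {K K'}, K ≤ K' → B K ≤ B K' := fun h T ⟨r, hr, hT⟩ =>
    ⟨r, levelAlgebra_mono h hr, hT⟩
  obtain ⟨K₁, hK₁, hLK₁, hK₀₁⟩ := exists_isCompactOpen_sup hL hK₀
  obtain ⟨_, ⟨K, ⟨hK, hK₁K⟩, rfl⟩, hmax⟩ := WellFounded.has_min
    (wellFounded_gt (α := Submodule ℂ (X →ₗ[ℂ] X)))
    (B '' {K | IsCompactOpen K ∧ K₁ ≤ K}) ⟨_, K₁, ⟨hK₁, le_rfl⟩, rfl⟩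
  refine ⟨K, hK, hK₀₁.trans hK₁K, hLK₁.trans hK₁K, fun x hx hx0 y hy => ?_⟩
  obtain ⟨r, hr⟩ : ∃ r : ℂ[G], r • x = y :=
    Submodule.mem_span_singleton.1
      ((IsSimpleModule.span_singleton_eq_top ℂ[G] hx0) ▸ Submodule.mem_top)
  obtain ⟨e, he, heX, hefix⟩ := exists_average hL.isCompact
    fun i => r • (Module.finBasis ℂ X i : M)
  have hmaps : ∀ z : X, (e * r) • (z : M) ∈ X := fun z => by
    have hcomm : SMulCommClass ℂ[G] ℂ M := IsScalarTower.to_smulCommClass'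
    rw [← (Module.finBasis ℂ X).sum_repr z]
    simp only [Submodule.coe_sum, Submodule.coe_smul, Finset.smul_sum]
    refine Submodule.sum_mem _ fun i _ => ?_
    rw [smul_comm, mul_smul]
    exact Submodule.smul_mem _ _ (heX i)
  let T : X →ₗ[ℂ] X :=
    { toFun := fun z => ⟨(e * r) • (z : M), hmaps z⟩
      map_add' := fun a b => Subtype.ext (smul_add (e * r) (a : M) (b : M))
      map_smul' := fun c a => Subtype.ext (by
        have hcomm : SMulCommClass ℂ[G] ℂ M := IsScalarTower.to_smulCommClass'
        exact smul_comm (e * r) c (a : M)) }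
  obtain ⟨K₂, hK₂, hrK₂⟩ := exists_mem_levelAlgebra r
  obtain ⟨K₃, hK₃, hKK₃, hK₂₃⟩ := exists_isCompactOpen_sup hK hK₂
  have hT : T ∈ B K₃ := ⟨e * r, mul_mem
    (levelAlgebra_mono ((hLK₁.trans hK₁K).trans hKK₃) he) (levelAlgebra_mono hK₂₃ hrK₂),
    fun _ => rfl⟩
  have hBeq : B K = B K₃ := (hBmono hKK₃).eq_of_not_lt
    (hmax _ ⟨K₃, ⟨hK₃, hK₁K.trans hKK₃⟩, rfl⟩)
  obtain ⟨s, hs, hTs⟩ := hBeq ▸ hT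
  refine ⟨s, hs, ?_⟩
  rw [← hTs ⟨x, hx⟩]
  change (e * r) • x = y
  rw [mul_smul, hr, hefix y hy]

end Irreducible

/-! ### Representations and modules over the group algebra -/

section Translation

variable {G : Type u} [Group G]

theorem single_smul_asModule {V : Type*} [AddCommGroup V] [Module ℂ V] (ρ : Representation ℂ G V)
    (g : G) (v : V) :
    single g (1 : ℂ) • ρ.asModuleEquiv.symm v = ρ.asModuleEquiv.symm (ρ g v) := by
  rw [Representation.asModuleEquiv_symm_map_rho, MonoidAlgebra.of_apply]

theorem coe_stab_asModule {V : Type*} [AddCommGroup V] [Module ℂ V] (ρ : Representation ℂ G V)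
    (v : V) : (stab G (ρ.asModuleEquiv.symm v) : Set G) = {g | ρ g v = v} := by
  ext g
  rw [SetLike.mem_coe, mem_stab, single_smul_asModule, EmbeddingLike.apply_eq_iff_eq]
  rfl

/-- The `ℂ[G]`-linear map underlying a morphism of representations. -/
noncomputable def linearOfHom {M N : Rep.{u} ℂ G} (f : M ⟶ N) : M.ρ.asModule →ₗ[ℂ[G]] N.ρ.asModule :=
  Representation.IntertwiningMap.equivLinearMapAsModule M.ρ N.ρ f.hom

/-- The morphism of representations given by a `ℂ[G]`-linear map. -/
noncomputable def homOfLinear {M N : Rep.{u} ℂ G} (f : M.ρ.asModule →ₗ[ℂ[G]] N.ρ.asModule) :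
    M ⟶ N :=
  Rep.ofHom ((Representation.IntertwiningMap.equivLinearMapAsModule M.ρ N.ρ).symm f)

theorem linearOfHom_homOfLinear {M N : Rep.{u} ℂ G} (f : M.ρ.asModule →ₗ[ℂ[G]] N.ρ.asModule) :
    linearOfHom (homOfLinear f) = f := rfl

/-- An isomorphism of representations as a `ℂ[G]`-linear equivalence. -/
noncomputable def linearEquivOfIso {M N : Rep.{u} ℂ G} (e : M ≅ N) :
    M.ρ.asModule ≃ₗ[ℂ[G]] N.ρ.asModule :=
  { linearOfHom e.hom with
    invFun := linearOfHom e.inv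
    left_inv := fun x => Rep.inv_hom_apply M N e (M.ρ.asModuleEquiv x)
    right_inv := fun x => Rep.hom_inv_apply M N e (N.ρ.asModuleEquiv x) }

variable (G) in
/-- The representation on the vector space underlying a `ℂ[G]`-module. -/
noncomputable def repOf (T : Type u) [AddCommGroup T] [Module ℂ[G] T] [Module ℂ T]
    [IsScalarTower ℂ ℂ[G] T] : Rep.{u} ℂ G :=
  Rep.of ((MonoidAlgebra.lift ℂ (Module.End ℂ T) G).symm (Algebra.lsmul ℂ ℂ T))

variable (G) (T : Type u) [AddCommGroup T] [Module ℂ[G] T] [Module ℂ T] [IsScalarTower ℂ ℂ[G] T]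

/-- The module of the representation on a module is that module. -/
noncomputable def repOfEquiv : (repOf G T).ρ.asModule ≃ₗ[ℂ[G]] T :=
  { (repOf G T).ρ.asModuleEquiv.toAddEquiv with
    map_smul' := fun r x => by
      have h : (repOf G T).ρ.asAlgebraHom = Algebra.lsmul ℂ ℂ T :=
        (MonoidAlgebra.lift ℂ (Module.End ℂ T) G).apply_symm_apply _
      exact ((repOf G T).ρ.asModuleEquiv_map_smul r x).trans (DFunLike.congr_fun
        (DFunLike.congr_fun h r) _) }

end Translation

section Dual

variable {G : Type u} [Group G] [TopologicalSpace G]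

theorem isSmoothModule_asModule_iff (M : Rep.{u} ℂ G) :
    IsSmoothModule G M.ρ.asModule ↔ IsSmooth M.ρ := by
  constructor
  · intro h v
    have := h.isOpen_stab (M.ρ.asModuleEquiv.symm v)
    rwa [coe_stab_asModule] at this
  · intro h
    refine ⟨fun v => ?_⟩
    rw [← M.ρ.asModuleEquiv.symm_apply_apply v, coe_stab_asModule]
    exact h _

theorem isSmooth_repOf (T : Type u) [AddCommGroup T] [Module ℂ[G] T] [Module ℂ T]
    [IsScalarTower ℂ ℂ[G] T] [IsSmoothModule G T] : IsSmooth (repOf G T).ρ :=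
  (isSmoothModule_asModule_iff _).1
    (.of_injective (repOfEquiv G T).toLinearMap (repOfEquiv G T).injective)

/-- The `ℂ[G]`-module of an element of the smooth dual. -/
abbrev SmoothDual.mod (π : SmoothDual G) : Type u := π.rep.ρ.asModule

instance (π : SmoothDual G) : IsSmoothModule G π.mod :=
  (isSmoothModule_asModule_iff _).2 π.isSmooth_rep

theorem isAdmissibleModule_mod [IsTame G] (π : SmoothDual G) : IsAdmissibleModule G π.mod :=
  fun L hL => by
    have h := (IsTame.admissible π.rep π.isSmooth_rep π.isIrreducible_rep).2 L hL.isOpen hL.isCompact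
    let f : (fixed L : Submodule ℂ π.mod) →ₗ[ℂ]
        Representation.invariants (π.rep.ρ.comp L.subtype) :=
      { toFun := fun x => ⟨(x : π.mod), fun l => by
          have h := mem_stab.1 (x.2 l.2)
          rw [← π.rep.ρ.asModuleEquiv.symm_apply_apply (x : π.mod), single_smul_asModule] at h
          exact h⟩
        map_add' := fun _ _ => rfl
        map_smul' := fun _ _ => rfl }
    exact FiniteDimensional.of_injective f fun a b hab =>
      Subtype.ext (congrArg (fun z => (z.1 : π.mod)) hab)

/-- Every smooth simple module is the module of an element of the smooth dual. -/
theorem exists_linearEquiv_mod (T : Type u) [AddCommGroup T] [Module ℂ[G] T] [Module ℂ T]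
    [IsScalarTower ℂ ℂ[G] T] [IsSmoothModule G T] [IsSimpleModule ℂ[G] T] :
    ∃ π : SmoothDual G, Nonempty (T ≃ₗ[ℂ[G]] π.mod) := by
  have hirr : (repOf G T).ρ.IsIrreducible :=
    (Representation.irreducible_iff_isSimpleModule_asModule _).2 (IsSimpleModule.congr (repOfEquiv G T))
  let M : IrreducibleSmooth G := ⟨repOf G T, isSmooth_repOf T, hirr⟩
  obtain ⟨e⟩ := SmoothDual.nonempty_iso_rep_mk M
  exact ⟨SmoothDual.mk M, ⟨(repOfEquiv G T).symm.trans (linearEquivOfIso e.symm)⟩⟩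

/-- A nonzero cyclic smooth module has an irreducible quotient in which the generator is nonzero. -/
theorem exists_linearMap_mod_ne_zero [IsTopologicalGroup G] {T : Type u} [AddCommGroup T]
    [Module ℂ[G] T] [Module ℂ T] [IsScalarTower ℂ ℂ[G] T] [IsSmoothModule G T] {v : T}
    (hv : v ≠ 0) (hspan : Submodule.span ℂ[G] {v} = ⊤) :
    ∃ (π : SmoothDual G) (f : T →ₗ[ℂ[G]] π.mod), Function.Surjective f ∧ f v ≠ 0 := by
  have hfin : Module.Finite ℂ[G] T := ⟨⟨{v}, by simpa using hspan⟩⟩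
  have : Nontrivial T := ⟨v, 0, hv⟩
  obtain ⟨N, hN⟩ := IsCoatomic.exists_coatom (Submodule ℂ[G] T)
  have : IsSimpleModule ℂ[G] (T ⧸ N) := isSimpleModule_iff_isCoatom.2 hN
  obtain ⟨π, ⟨e⟩⟩ := exists_linearEquiv_mod (G := G) (T ⧸ N)
  refine ⟨π, e.toLinearMap ∘ₗ N.mkQ, e.surjective.comp N.mkQ_surjective, fun h => hN.1 ?_⟩
  have hvN : v ∈ N := by
    rw [← N.ker_mkQ, LinearMap.mem_ker]
    exact e.injective (h.trans (map_zero e).symm)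
  rw [eq_top_iff, ← hspan]
  exact Submodule.span_le.2 (Set.singleton_subset_iff.2 hvN)

end Dual

/-! ### The Fell topology in terms of types -/

section Fell

variable {G : Type u} [Group G]

theorem fixed_mono {M : Type*} [AddCommGroup M] [Module ℂ[G] M] [Module ℂ M]
    [IsScalarTower ℂ ℂ[G] M] {L L' : Subgroup G} (h : L ≤ L') :
    (fixed L' : Submodule ℂ M) ≤ fixed L := fun _ hx => h.trans hx

variable [TopologicalSpace G]

theorem exists_ne_zero_mod (π : SmoothDual G) : ∃ v : π.mod, v ≠ 0 :=
  have := IsSimpleModule.nontrivial ℂ[G] π.mod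
  exists_ne 0

/-- The `σ` in the smooth dual whose restriction to `K` contains a nonzero quotient of the
`K`-representation generated by `v`. If the latter is irreducible, this says that `σ` contains it. -/
def containing (K : Subgroup G) {M : Type*} [AddCommGroup M] [Module ℂ[G] M] (v : M) :
    Set (SmoothDual G) :=
  {σ | ∃ u : σ.mod, u ≠ 0 ∧ ∀ s ∈ levelAlgebra K, s • v = 0 → s • u = 0}

/-- The `σ` in the smooth dual whose restriction to `K` has the `K`-representation generated by
the `L`-fixed vectors of `π` as a subquotient (and hence, by semisimplicity, as a
subrepresentation). -/
def dominating (π : SmoothDual G) (L K : Subgroup G) : Set (SmoothDual G) :=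
  {σ | ∃ p : σ.mod →ₗ[levelAlgebra K] π.mod, ∀ x ∈ (fixed L : Submodule ℂ π.mod),
    x ∈ LinearMap.range p}

variable [IsEllCGroup G]

theorem exists_isCompactOpen_forall_le_stab {M : Type*} [AddCommGroup M] [Module ℂ[G] M]
    [IsSmoothModule G M] {ι : Type*} [Finite ι] (w : ι → M) :
    ∃ L : Subgroup G, IsCompactOpen L ∧ ∀ i, L ≤ stab G (w i) := by
  obtain ⟨K, hK⟩ := exists_isCompactOpen G
  refine ⟨K ⊓ ⨅ i, stab G (w i), hK.inf_of_isOpen ?_, fun i => inf_le_right.trans (iInf_le _ i)⟩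
  rw [Subgroup.coe_iInf]
  exact isOpen_iInter_of_finite fun i => IsSmoothModule.isOpen_stab _

/-- Matrix coefficients of `σ` on `K` are matrix coefficients of all representations which dominate
`σ`. -/
theorem exists_dominating_subset_fellNhd {π σ : SmoothDual G} {n : ℕ} {v : Fin n → π.rep}
    {ξ : Fin n → Module.Dual ℂ π.rep} {B : Set G} {ε : ℝ} (hB : IsCompact B)
    (hσ : σ ∈ fellNhd π v ξ B ε) :
    ∃ L K₀ : Subgroup G, IsCompactOpen L ∧ IsCompactOpen K₀ ∧
      ∀ K, IsCompactOpen K → K₀ ≤ K → dominating σ L K ⊆ fellNhd π v ξ B ε := by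
  obtain ⟨w, ζ, hζ, hclose⟩ := hσ
  obtain ⟨L, hL, hLw⟩ := exists_isCompactOpen_forall_le_stab (G := G)
    fun j => σ.rep.ρ.asModuleEquiv.symm (w j)
  obtain ⟨K₀, hK₀, hBK₀⟩ := exists_isCompactOpen_subset hB
  refine ⟨L, K₀, hL, hK₀, fun K hK hK₀K τ ⟨p, hp⟩ => ?_⟩
  choose w' hw' using fun j => hp _ (hLw j)
  let q : τ.rep →ₗ[ℂ] σ.rep := σ.rep.ρ.asModuleEquiv.toLinearMap ∘ₗ p.restrictScalars ℂ ∘ₗ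
    τ.rep.ρ.asModuleEquiv.symm.toLinearMap
  have hq : ∀ g ∈ K, ∀ x : τ.rep, q (τ.rep.ρ g x) = σ.rep.ρ g (q x) := fun g hg x => by
    have h := p.map_smul (levelOf K ⟨g, hg⟩) (τ.rep.ρ.asModuleEquiv.symm x)
    rw [levelOf_smul, levelOf_smul, single_smul_asModule] at h
    exact σ.rep.ρ.asModuleEquiv.symm.injective (h.trans (single_smul_asModule σ.rep.ρ g (q x)))
  have hqw : ∀ j, q (τ.rep.ρ.asModuleEquiv (w' j)) = w j := hw'
  refine ⟨fun j => τ.rep.ρ.asModuleEquiv (w' j), fun j => (ζ j).comp q, fun j => ?_,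
    fun j g hg => ?_⟩
  · have h1 : IsOpen (stab G (σ.rep.ρ.dual.asModuleEquiv.symm (ζ j)) : Set G) := by
      rw [coe_stab_asModule]
      exact hζ j
    change IsOpen {g | τ.rep.ρ.dual g ((ζ j).comp q) = (ζ j).comp q}
    rw [← coe_stab_asModule]
    refine Subgroup.isOpen_mono (H₁ := K ⊓ stab G (σ.rep.ρ.dual.asModuleEquiv.symm (ζ j))) ?_
      (hK.isOpen.inter h1)
    intro g hg
    obtain ⟨hgK, hgζ⟩ := Subgroup.mem_inf.1 hg
    rw [mem_stab, single_smul_asModule, EmbeddingLike.apply_eq_iff_eq] at hgζ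
    rw [mem_stab, single_smul_asModule, EmbeddingLike.apply_eq_iff_eq]
    refine LinearMap.ext fun x => ?_
    change ζ j (q (τ.rep.ρ g⁻¹ x)) = ζ j (q x)
    rw [hq _ (K.inv_mem hgK)]
    exact LinearMap.congr_fun hgζ (q x)
  · rw [LinearMap.comp_apply, hq g (hK₀K (hBK₀ hg)), hqw]
    exact hclose j g hg

/-- The sets `dominating π L K` with small `L` and large `K` are arbitrarily small neighbourhoods of `π`.
Here `K` may be enlarged once `L` is chosen, which allows `K` to be taken so large that it acts
irreducibly on the vectors fixed by `L`. -/
theorem exists_dominating_subset {O : Set (SmoothDual G)} (hO : IsOpen O) {π : SmoothDual G}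
    (hπ : π ∈ O) :
    ∃ L K₀ : Subgroup G, IsCompactOpen L ∧ IsCompactOpen K₀ ∧
      ∀ K, IsCompactOpen K → K₀ ≤ K → dominating π L K ⊆ O := by
  induction hO generalizing π with
  | basic s hs =>
    obtain ⟨σ, n, v, ξ, B, ε, -, hB, -, rfl⟩ := hs
    exact exists_dominating_subset_fellNhd hB hπ
  | univ =>
    obtain ⟨K, hK⟩ := exists_isCompactOpen G
    exact ⟨K, K, hK, hK, fun _ _ _ => Set.subset_univ _⟩
  | inter s t _ _ ihs iht =>
    obtain ⟨L₁, K₁, hL₁, hK₁, h₁⟩ := ihs hπ.1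
    obtain ⟨L₂, K₂, hL₂, hK₂, h₂⟩ := iht hπ.2
    obtain ⟨K₀, hK₀, h₁₀, h₂₀⟩ := exists_isCompactOpen_sup hK₁ hK₂
    exact ⟨L₁ ⊓ L₂, K₀, hL₁.inf_of_isOpen hL₂.isOpen, hK₀, fun K hK hK₀K σ ⟨p, hp⟩ =>
      ⟨h₁ K hK (h₁₀.trans hK₀K) ⟨p, fun x hx => hp x (fixed_mono inf_le_left hx)⟩,
        h₂ K hK (h₂₀.trans hK₀K) ⟨p, fun x hx => hp x (fixed_mono inf_le_right hx)⟩⟩⟩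
  | sUnion S _ ih =>
    obtain ⟨s, hs, hπs⟩ := hπ
    obtain ⟨L, K₀, hL, hK₀, h⟩ := ih s hs hπs
    exact ⟨L, K₀, hL, hK₀, fun K hK hK₀K => (h K hK hK₀K).trans (Set.subset_sUnion_of_mem hs)⟩

/-- The sets `containing K v` for compact open `K` and nonzero `v : π.mod` are arbitrarily small: take
`K` so large that `ℂ[K]` acts transitively on the nonzero `L`-fixed vectors of `π` and `v` fixed by
`L`. Any nonzero `ℂ[K]`-quotient of the representation generated by `v` then contains a nonzero
`L`-fixed vector of `π`, hence all of them. -/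
theorem exists_containing_subset [IsTame G] {O : Set (SmoothDual G)} (hO : IsOpen O)
    {π : SmoothDual G} (hπ : π ∈ O) :
    ∃ (K : Subgroup G) (v : π.mod), IsCompactOpen K ∧ v ≠ 0 ∧ containing K v ⊆ O := by
  obtain ⟨L₀, K₀, hL₀, hK₀, hO⟩ := exists_dominating_subset hO hπ
  obtain ⟨v, hv⟩ := exists_ne_zero_mod π
  have hL : IsCompactOpen (L₀ ⊓ stab G v) := hL₀.inf_of_isOpen (IsSmoothModule.isOpen_stab v)
  obtain ⟨K, hK, hK₀K, hLK, htrans⟩ :=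
    exists_isCompactOpen_forall_exists_smul_eq (isAdmissibleModule_mod π) hL hK₀
  refine ⟨K, v, hK, hv, fun σ ⟨u, hu, hvu⟩ => hO K hK hK₀K ?_⟩
  have := isSemisimpleModule_levelAlgebra (M := π.mod) hK.isCompact
  have := isSemisimpleModule_levelAlgebra (M := σ.mod) hK.isCompact
  -- lift `u` along the surjection from the `K`-span of `v` to that of `u`
  obtain ⟨f, hf⟩ := exists_linearMap_span_singleton (A := levelAlgebra K) v u
    fun s => hvu s.1 s.2
  let v' : Submodule.span (levelAlgebra K) {v} := ⟨(1 : levelAlgebra K) • v,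
    Submodule.mem_span_singleton.2 ⟨1, rfl⟩⟩
  have hfv' : f v' = u := by rw [hf, one_smul]
  obtain ⟨x, hfx, hux⟩ := exists_lift_of_isSemisimpleModule f v'
  rw [hfv'] at hfx hux
  obtain ⟨p₀, hp₀⟩ := exists_linearMap_span_singleton (A := levelAlgebra K) u (x : π.mod)
    fun s hs => congrArg Subtype.val (hux s hs)
  obtain ⟨p, hp⟩ := exists_extend_of_isSemisimpleModule p₀
  have hpu : p u = x := by
    have h := (hp _).trans (hp₀ 1)
    simpa using h
  have hx0 : (x : π.mod) ≠ 0 := fun h => hu (by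
    rw [← hfx, show x = 0 from Subtype.ext h, map_zero])
  have hxfix : (x : π.mod) ∈ (fixed (L₀ ⊓ stab G v) : Submodule ℂ π.mod) := fun l hl => by
    rw [← single_sub_one_smul_eq_zero]
    have hmem : (single l (1 : ℂ) - 1 : ℂ[G]) ∈ levelAlgebra K :=
      sub_mem (single_mem_levelAlgebra (hLK hl) 1) (one_mem _)
    exact congrArg Subtype.val (hux ⟨_, hmem⟩ (hvu _ hmem (single_sub_one_smul_eq_zero.2 hl.2)))
  refine ⟨p, fun y hy => ?_⟩
  obtain ⟨s, hs, hsx⟩ := htrans x hxfix hx0 y (fixed_mono inf_le_left hy)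
  exact ⟨(⟨s, hs⟩ : levelAlgebra K) • u, by rw [map_smul, hpu]; exact hsx⟩

end Fell

/-! ### Neighbourhoods in the Fell topology -/

section Nhds

variable {G : Type u} [Group G]

/-- The universal `ℂ[G]`-module with a generator fixed by `L`. -/
abbrev CosetModule (L : Subgroup G) : Type u :=
  ℂ[G] ⧸ Submodule.span ℂ[G] {r : ℂ[G] | ∃ l ∈ L, r = single l (1 : ℂ) - 1}

/-- The generator of `CosetModule L`. -/
noncomputable abbrev cosetGen (L : Subgroup G) : CosetModule L := Submodule.Quotient.mk 1

theorem exists_linearMap_cosetModule {L : Subgroup G} {M : Type*} [AddCommGroup M] [Module ℂ[G] M]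
    {w : M} (hw : L ≤ stab G w) : ∃ f : CosetModule L →ₗ[ℂ[G]] M, f (cosetGen L) = w := by
  refine ⟨Submodule.liftQ _ (LinearMap.toSpanSingleton ℂ[G] M w) ?_, ?_⟩
  · rw [Submodule.span_le]
    rintro _ ⟨l, hl, rfl⟩
    simpa using single_sub_one_smul_eq_zero.2 (hw hl)
  · exact one_smul ℂ[G] w

/-- Averaging over a finite subset of `L` preserves closeness to a matrix coefficient of a vector
fixed by `L`. -/
theorem norm_sub_average_le {M N : Type*} [AddCommGroup M] [Module ℂ[G] M] [Module ℂ M]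
    [AddCommGroup N] [Module ℂ[G] N] [Module ℂ N] [IsScalarTower ℂ ℂ[G] N]
    (ξ : M →ₗ[ℂ] ℂ) (ζ : N →ₗ[ℂ] ℂ) {v : M} {w : N} {K L : Subgroup G} (hLK : L ≤ K)
    (hv : L ≤ stab G v) {ε : ℝ}
    (h : ∀ g ∈ K, ‖ξ (single g (1 : ℂ) • v) - ζ (single g (1 : ℂ) • w)‖ < ε) {s : Finset G}
    (hs : s.Nonempty) (hsL : ∀ l ∈ s, l ∈ L) {g : G} (hg : g ∈ K) :
    ‖ξ (single g (1 : ℂ) • v) -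
      ζ (single g (1 : ℂ) • (s.card : ℂ)⁻¹ • ∑ l ∈ s, single l (1 : ℂ) • w)‖ ≤ ε := by
  have hcomm : SMulCommClass ℂ[G] ℂ N := IsScalarTower.to_smulCommClass'
  have hcard : (s.card : ℂ) ≠ 0 := Nat.cast_ne_zero.2 hs.card_pos.ne'
  have key : ξ (single g (1 : ℂ) • v) -
      ζ (single g (1 : ℂ) • (s.card : ℂ)⁻¹ • ∑ l ∈ s, single l (1 : ℂ) • w) =
      (s.card : ℂ)⁻¹ * ∑ l ∈ s, (ξ (single (g * l) (1 : ℂ) • v) - ζ (single (g * l) (1 : ℂ) • w)) := by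
    rw [smul_comm, map_smul ζ, Finset.smul_sum, map_sum, Finset.sum_sub_distrib, mul_sub, smul_eq_mul]
    congr 1
    · rw [Finset.sum_congr rfl fun l hl => by
        rw [single_mul_smul, mem_stab.1 (hv (hsL l hl))], Finset.sum_const, nsmul_eq_mul,
        inv_mul_cancel_left₀ hcard]
    · simp only [single_mul_smul]
  rw [key, norm_mul, norm_inv, Complex.norm_natCast, inv_mul_le_iff₀ (Nat.cast_pos.2 hs.card_pos),
    ← nsmul_eq_mul]
  exact (norm_sum_le _ _).trans (Finset.sum_le_card_nsmul _ _ _ fun l hl =>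
    (h _ (K.mul_mem hg (hLK (hsL l hl)))).le)

variable [TopologicalSpace G]

theorem isSmoothModule_quotient [IsTopologicalGroup G] {J : Submodule ℂ[G] ℂ[G]} {L : Subgroup G}
    (hL : IsOpen (L : Set G)) (hLJ : ∀ l ∈ L, (single l (1 : ℂ) - 1 : ℂ[G]) ∈ J) :
    IsSmoothModule G (ℂ[G] ⧸ J) := by
  refine .of_span_eq_top (Submodule.Quotient.mk 1) (Subgroup.isOpen_mono (fun l hl => ?_) hL) ?_
  · rw [← single_sub_one_smul_eq_zero, ← Submodule.Quotient.mk_smul, Submodule.Quotient.mk_eq_zero,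
      smul_eq_mul, mul_one]
    exact hLJ l hl
  · rw [Submodule.eq_top_iff']
    intro x
    obtain ⟨r, rfl⟩ := Submodule.Quotient.mk_surjective _ x
    exact Submodule.mem_span_singleton.2 ⟨r, by
      rw [← Submodule.Quotient.mk_smul, smul_eq_mul, mul_one]⟩

variable [IsEllCGroup G]

/-- An element `e` of `ℂ[K]` fixing `v`, such that on vectors fixed by `L` all relations satisfied by
`v` are satisfied after applying `e`. It comes from splitting the surjection from the permutation
representation of `K` on `K / L` to the representation generated by `v`. -/
theorem exists_smul_eq_self_and_forall_smul_eq_zero {M : Type*} [AddCommGroup M] [Module ℂ[G] M]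
    {v : M} {K L : Subgroup G} (hK : IsCompact (K : Set G)) (hL : IsOpen (L : Set G))
    (hv : L ≤ stab G v) :
    ∃ e ∈ levelAlgebra K, e • v = v ∧ ∀ σ : SmoothDual G, ∀ w : σ.mod, L ≤ stab G w →
      ∀ s ∈ levelAlgebra K, s • v = 0 → s • e • w = 0 := by
  have : IsSmoothModule G (CosetModule L) :=
    isSmoothModule_quotient hL fun l hl => Submodule.subset_span ⟨l, hl, rfl⟩
  have := isSemisimpleModule_levelAlgebra (M := CosetModule L) hK
  obtain ⟨f, hf⟩ := exists_linearMap_cosetModule hv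
  let fK : Submodule.span (levelAlgebra K) {cosetGen L} →ₗ[levelAlgebra K] M :=
    f.restrictScalars (levelAlgebra K) ∘ₗ Submodule.subtype _
  obtain ⟨⟨x, hx⟩, hfx, hann⟩ := exists_lift_of_isSemisimpleModule (A := levelAlgebra K)
    (M := Submodule.span (levelAlgebra K) {cosetGen L}) fK
    ⟨cosetGen L, Submodule.mem_span_singleton_self _⟩
  obtain ⟨e, rfl⟩ := Submodule.mem_span_singleton.1 hx
  have hfgen : fK ⟨cosetGen L, Submodule.mem_span_singleton_self _⟩ = v := hf
  rw [hfgen] at hfx hann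
  refine ⟨e.1, e.2, ?_, fun σ w hw s hs hsv => ?_⟩
  · have h : f ((e : ℂ[G]) • cosetGen L) = v := hfx
    rwa [map_smul, hf] at h
  · obtain ⟨g, hg⟩ := exists_linearMap_cosetModule hw
    have h : s • (e : ℂ[G]) • cosetGen L = 0 := congrArg Subtype.val (hann ⟨s, hs⟩ hsv)
    rw [← hg, ← map_smul, ← map_smul, h, map_zero]

/-- A nonzero smooth vector is detected by a functional invariant under its stabilizer in a compact
group. -/
theorem exists_dual_apply_eq_one {M : Type*} [AddCommGroup M] [Module ℂ[G] M] [Module ℂ M]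
    [IsScalarTower ℂ ℂ[G] M] [IsSmoothModule G M] {v : M} (hv : v ≠ 0) {L : Subgroup G}
    (hL : IsCompact (L : Set G)) (hLv : L ≤ stab G v) :
    ∃ ξ : M →ₗ[ℂ] ℂ, ξ v = 1 ∧ ∀ l ∈ L, ∀ x, ξ (single l (1 : ℂ) • x) = ξ x := by
  have := isSemisimpleModule_levelAlgebra (M := M) hL
  let T := Submodule.span (levelAlgebra L) {v}
  obtain ⟨p, hp⟩ := exists_extend_of_isSemisimpleModule (A := levelAlgebra L) (M := M) (Q := T)
    LinearMap.id
  have hfix : ∀ x : T, ((x : M) : M) ∈ (fixed L : Submodule ℂ M) := fun x => by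
    obtain ⟨r, hr⟩ := Submodule.mem_span_singleton.1 x.2
    rw [← hr]
    clear hr
    induction r using levelAlgebra_induction with
    | h0 => rw [zero_smul]; exact zero_mem _
    | hadd a b ha hb => rw [add_smul]; exact add_mem ha hb
    | hsmul c k =>
      rw [smul_assoc, levelOf_smul, mem_stab.1 (hLv k.2)]
      exact Submodule.smul_mem _ c hLv
  obtain ⟨ξ₀, hξ₀⟩ : ∃ ξ₀ : Module.Dual ℂ M, ξ₀ v ≠ 0 := by
    by_contra! h
    exact hv ((Module.forall_dual_apply_eq_zero_iff ℂ v).1 h)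
  let q : M →ₗ[ℂ] M := (T.subtype ∘ₗ p).restrictScalars ℂ
  have hqv : q v = v := congrArg Subtype.val (hp ⟨v, Submodule.mem_span_singleton_self v⟩)
  have hql : ∀ l ∈ L, ∀ x, q (single l (1 : ℂ) • x) = q x := fun l hl x =>
    (congrArg Subtype.val (p.map_smul (levelOf L ⟨l, hl⟩) x)).trans (hfix (p x) hl)
  refine ⟨(ξ₀ v)⁻¹ • ξ₀ ∘ₗ q, ?_, fun l hl x => ?_⟩
  · rw [LinearMap.smul_apply, LinearMap.comp_apply, hqv, smul_eq_mul, inv_mul_cancel₀ hξ₀]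
  · rw [LinearMap.smul_apply, LinearMap.smul_apply, LinearMap.comp_apply, LinearMap.comp_apply,
      hql l hl]

/-- A matrix coefficient of `v` is only approximated on `K` by matrix coefficients of
representations which contain a nonzero quotient of the `K`-representation generated by `v`. -/
theorem containing_mem_nhds {π : SmoothDual G} {K : Subgroup G} (hK : IsCompactOpen K) {v : π.mod}
    (hv : v ≠ 0) : containing K v ∈ 𝓝 π := by
  have hL : IsCompactOpen (K ⊓ stab G v) := hK.inf_of_isOpen (IsSmoothModule.isOpen_stab v)
  obtain ⟨ξ, hξv, hξ⟩ := exists_dual_apply_eq_one hv hL.isCompact inf_le_right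
  obtain ⟨e, he, hev, hann⟩ :=
    exists_smul_eq_self_and_forall_smul_eq_zero hK.isCompact hL.isOpen
      (inf_le_right : K ⊓ stab G v ≤ stab G v)
  -- the sum of the coefficients of `e` bounds the effect of `e` on an error, so the tolerance
  -- `(C + 1)⁻¹` keeps the value at `e` within distance less than `1` of `ξ (e • v) = 1`
  let C : ℝ := ∑ g ∈ e.coeff.support, ‖e.coeff g‖
  have hC : 0 ≤ C := Finset.sum_nonneg fun g _ => norm_nonneg _
  let ξ' : Module.Dual ℂ π.rep := ξ ∘ₗ π.rep.ρ.asModuleEquiv.symm.toLinearMap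
  let v' : π.rep := π.rep.ρ.asModuleEquiv v
  have hξ' : ∀ g, ξ' (π.rep.ρ g v') = ξ (single g (1 : ℂ) • v) := fun g =>
    congrArg ξ (single_smul_asModule π.rep.ρ g v').symm
  have hsm : IsSmoothVector π.rep.ρ.dual ξ' := by
    change IsOpen {g | π.rep.ρ.dual g ξ' = ξ'}
    rw [← coe_stab_asModule]
    refine Subgroup.isOpen_mono (fun l hl => ?_) hL.isOpen
    rw [mem_stab, single_smul_asModule, EmbeddingLike.apply_eq_iff_eq]
    refine LinearMap.ext fun x => ?_
    change ξ (π.rep.ρ.asModuleEquiv.symm (π.rep.ρ l⁻¹ x)) = ξ (π.rep.ρ.asModuleEquiv.symm x)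
    rw [← single_smul_asModule]
    exact hξ _ (inv_mem hl) _
  have hopen : IsOpen (fellNhd π (fun _ : Fin 1 => v') (fun _ => ξ') (K : Set G) (C + 1)⁻¹) := by
    exact TopologicalSpace.isOpen_generateFrom_of_mem ⟨π, 1, _, _, _, _, fun _ => hsm, hK.isCompact,
      by positivity, rfl⟩
  have hmem : π ∈ fellNhd π (fun _ : Fin 1 => v') (fun _ => ξ') (K : Set G) (C + 1)⁻¹ := by
    refine ⟨fun _ => v', fun _ => ξ', fun _ => hsm, fun j g _ => ?_⟩
    rw [sub_self, norm_zero]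
    positivity
  refine Filter.mem_of_superset (hopen.mem_nhds hmem) ?_
  rintro σ ⟨w, ζ, -, hclose⟩
  let w₀ : σ.mod := σ.rep.ρ.asModuleEquiv.symm (w 0)
  let ζ₀ : σ.mod →ₗ[ℂ] ℂ := ζ 0 ∘ₗ σ.rep.ρ.asModuleEquiv.toLinearMap
  have hclose₀ : ∀ g ∈ K, ‖ξ (single g (1 : ℂ) • v) - ζ₀ (single g (1 : ℂ) • w₀)‖ < (C + 1)⁻¹ := by
    intro g hg
    have h := hclose 0 g hg
    rw [hξ'] at h
    rw [single_smul_asModule]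
    exact h
  -- `w₀` need not be fixed by `K ⊓ stab G v`, but its average is as good an approximation
  obtain ⟨s, hs, hsL, hfix⟩ := exists_finset_sum_smul_mem_fixed hL.isCompact fun _ : Fin 1 => w₀
  let w₁ : σ.mod := (s.card : ℂ)⁻¹ • ∑ l ∈ s, single l (1 : ℂ) • w₀
  have hw₁ : K ⊓ stab G v ≤ stab G w₁ :=
    Submodule.smul_mem (fixed (K ⊓ stab G v) : Submodule ℂ σ.mod) _ (hfix 0)
  have hclose₁ : ∀ g ∈ K, ‖ξ (single g (1 : ℂ) • v) - ζ₀ (single g (1 : ℂ) • w₁)‖ ≤ (C + 1)⁻¹ :=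
    fun g hg => norm_sub_average_le ξ ζ₀ inf_le_left inf_le_right hclose₀ hs hsL hg
  refine ⟨e • w₁, fun h0 => ?_, fun t ht htv => hann σ w₁ hw₁ t ht htv⟩
  have h1 : (1 : ℂ) = ∑ g ∈ e.coeff.support, e.coeff g *
      (ξ (single g (1 : ℂ) • v) - ζ₀ (single g (1 : ℂ) • w₁)) := by
    have h2 := congrArg ξ ((smul_eq_sum e v).symm.trans hev)
    have h3 := congrArg ζ₀ ((smul_eq_sum e w₁).symm.trans h0)
    simp only [map_sum, map_smul, smul_eq_mul, map_zero] at h2 h3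
    simp only [mul_sub, Finset.sum_sub_distrib]
    rw [h2, h3, hξv, sub_zero]
  have h2 : (1 : ℝ) ≤ C * (C + 1)⁻¹ := by
    calc (1 : ℝ) = ‖(1 : ℂ)‖ := norm_one.symm
      _ ≤ ∑ g ∈ e.coeff.support, ‖e.coeff g‖ * (C + 1)⁻¹ := by
        rw [h1]
        refine (norm_sum_le _ _).trans (Finset.sum_le_sum fun g hg => ?_)
        rw [norm_mul]
        exact mul_le_mul_of_nonneg_left (hclose₁ g (he g hg)) (norm_nonneg _)
      _ = C * (C + 1)⁻¹ := (Finset.sum_mul _ _ _).symm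
  rw [← div_eq_mul_inv, le_div_iff₀ (by positivity)] at h2
  linarith

end Nhds

/-! ### Supports -/

section Support

variable {G : Type u} [Group G] [TopologicalSpace G]

/-- All irreducible quotients of `M` lie in `S`. -/
def SupportedOn (S : Set (SmoothDual G)) (M : Type*) [AddCommGroup M] [Module ℂ[G] M] : Prop :=
  ∀ (σ : SmoothDual G) (φ : M →ₗ[ℂ[G]] σ.mod), φ ≠ 0 → σ ∈ S

theorem supportedOn_asModule_iff {S : Set (SmoothDual G)} {M : Rep.{u} ℂ G} :
    SupportedOn S M.ρ.asModule ↔ support M ⊆ S := by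
  constructor
  · rintro h σ ⟨f, hf⟩
    exact h σ (linearOfHom f) fun h0 => hf (Rep.hom_ext
      ((Representation.IntertwiningMap.equivLinearMapAsModule M.ρ σ.rep.ρ).injective
        (h0.trans (map_zero _).symm)))
  · intro h σ φ hφ
    refine h ⟨homOfLinear φ, fun h0 => hφ ?_⟩
    rw [← linearOfHom_homOfLinear φ, h0]
    exact map_zero (Representation.IntertwiningMap.equivLinearMapAsModule M.ρ σ.rep.ρ)

theorem smoothOn_iff {W : Set (SmoothDual G)} {M : Rep.{u} ℂ G} :
    smoothOn W M ↔ IsSmoothModule G M.ρ.asModule ∧ SupportedOn W M.ρ.asModule := by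
  rw [supportedOn_asModule_iff, isSmoothModule_asModule_iff]
  rfl

section

variable {M N : Type*} [AddCommGroup M] [Module ℂ[G] M] [AddCommGroup N] [Module ℂ[G] N]
  {S T : Set (SmoothDual G)}

theorem SupportedOn.mono (h : SupportedOn S M) (hST : S ⊆ T) : SupportedOn T M :=
  fun σ φ hφ => hST (h σ φ hφ)

theorem SupportedOn.of_surjective (h : SupportedOn S M) (f : M →ₗ[ℂ[G]] N)
    (hf : Function.Surjective f) : SupportedOn S N := fun σ φ hφ =>
  h σ (φ ∘ₗ f) fun h0 => hφ (LinearMap.ext fun n => by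
    obtain ⟨m, rfl⟩ := hf n
    exact LinearMap.congr_fun h0 m)

theorem supportedOn_mod {π : SmoothDual G} (hπ : π ∈ S) : SupportedOn S π.mod :=
  supportedOn_asModule_iff.2 fun _ hσ => mem_support_rep hσ ▸ hπ

/-- Since irreducible representations of tame groups are injective, irreducible quotients of a
subrepresentation are quotients of the whole representation. -/
theorem SupportedOn.of_injective [IsEllCGroup G] [IsTame G] [IsSmoothModule G M] [Module ℂ M]
    [IsScalarTower ℂ ℂ[G] M] (h : SupportedOn S M) (f : N →ₗ[ℂ[G]] M)
    (hf : Function.Injective f) : SupportedOn S N := fun σ φ hφ => by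
  let e := LinearEquiv.ofInjective f hf
  obtain ⟨ψ, hψ⟩ := (isAdmissibleModule_mod σ).exists_extend (M := M) (φ ∘ₗ e.symm.toLinearMap)
  refine h σ ψ fun h0 => hφ (LinearMap.ext fun n => ?_)
  have h1 := hψ (e n)
  rw [h0, LinearMap.comp_apply, LinearEquiv.coe_coe, e.symm_apply_apply] at h1
  exact h1.symm

/-- The largest submodule of `M` supported on `S`. -/
noncomputable def part (S : Set (SmoothDual G)) (M : Type*) [AddCommGroup M] [Module ℂ[G] M] :
    Submodule ℂ[G] M :=
  sSup {P | SupportedOn S P}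

theorem le_part {P : Submodule ℂ[G] M} (h : SupportedOn S P) : P ≤ part S M := le_sSup h

theorem supportedOn_part : SupportedOn S (part S M) := fun σ φ hφ => by
  by_contra hσ
  refine hφ (LinearMap.ext fun x => ?_)
  have hle : part S M ≤ (LinearMap.ker φ).map (part S M).subtype := by
    refine sSup_le fun P hP y hy => ?_
    have h0 : φ ∘ₗ Submodule.inclusion (le_part hP) = 0 := by
      by_contra h
      exact hσ (hP σ _ h)
    exact ⟨⟨y, le_part hP hy⟩, LinearMap.congr_fun h0 ⟨y, hy⟩, rfl⟩
  obtain ⟨y, hy, hyx⟩ := hle x.2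
  rw [← show y = x from Subtype.ext hyx]
  exact hy

theorem part_mono (h : S ⊆ T) : part S M ≤ part T M := le_part (supportedOn_part.mono h)

theorem part_eq_top (h : SupportedOn S M) : part S M = ⊤ :=
  top_le_iff.1 (le_part (h.of_surjective Submodule.topEquiv.symm.toLinearMap
    Submodule.topEquiv.symm.surjective))

theorem map_mem_part (f : M →ₗ[ℂ[G]] N) {x : M} (hx : x ∈ part S M) : f x ∈ part S N :=
  le_part (supportedOn_part.of_surjective (f.submoduleMap (part S M))
    (f.submoduleMap_surjective _)) (Submodule.mem_map_of_mem hx)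

end

variable [IsEllCGroup G] [IsTame G] {M : Type u} [AddCommGroup M] [Module ℂ[G] M] [Module ℂ M]
  [IsScalarTower ℂ ℂ[G] M] [IsSmoothModule G M]

/-- Every nonzero vector of a smooth module survives in some irreducible quotient. -/
theorem exists_linearMap_mod_apply_ne_zero {v : M} (hv : v ≠ 0) :
    ∃ (π : SmoothDual G) (f : M →ₗ[ℂ[G]] π.mod), f v ≠ 0 := by
  have hspan : Submodule.span ℂ[G]
      {(⟨v, Submodule.mem_span_singleton_self v⟩ : Submodule.span ℂ[G] {v})} = ⊤ := by
    rw [Submodule.eq_top_iff']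
    rintro ⟨x, hx⟩
    obtain ⟨r, rfl⟩ := Submodule.mem_span_singleton.1 hx
    exact Submodule.mem_span_singleton.2 ⟨r, rfl⟩
  obtain ⟨π, f, -, hf⟩ := exists_linearMap_mod_ne_zero (G := G)
    (fun h => hv (congrArg Subtype.val h)) hspan
  obtain ⟨ψ, hψ⟩ := (isAdmissibleModule_mod π).exists_extend f
  exact ⟨π, ψ, by rwa [← hψ] at hf⟩

theorem disjoint_part {S T : Set (SmoothDual G)} (hST : Disjoint S T) :
    Disjoint (part S M) (part T M) := by
  rw [disjoint_iff_inf_le]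
  intro v hv
  by_contra h
  obtain ⟨π, f, hf⟩ := exists_linearMap_mod_apply_ne_zero (G := G)
    (M := (part S M ⊓ part T M : Submodule ℂ[G] M)) (v := ⟨v, hv⟩)
    (fun h0 => h (congrArg Subtype.val h0))
  have hf0 : f ≠ 0 := fun h => hf (by rw [h]; rfl)
  exact Set.disjoint_left.1 hST
    (supportedOn_part.of_injective _ (Submodule.inclusion_injective inf_le_left) π f hf0)
    (supportedOn_part.of_injective _ (Submodule.inclusion_injective inf_le_right) π f hf0)

end Support

/-! ### Locally constant functions act -/

section LocallyConstant

variable {G : Type u} [Group G] [TopologicalSpace G]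

/-- The level set of a function on a subset of the smooth dual. -/
def level {W : Set (SmoothDual G)} (f : W → ℂ) (c : ℂ) : Set (SmoothDual G) :=
  Subtype.val '' (f ⁻¹' {c})

theorem disjoint_level {W : Set (SmoothDual G)} (f : W → ℂ) {c d : ℂ} (h : c ≠ d) :
    Disjoint (level f c) (level f d) := by
  rw [Set.disjoint_left]
  rintro _ ⟨x, hx, rfl⟩ ⟨y, hy, hyx⟩
  obtain rfl := Subtype.ext hyx
  exact h (hx.symm.trans hy)

variable [IsEllCGroup G] [IsTame G] {M : Type u} [AddCommGroup M] [Module ℂ[G] M] [Module ℂ M]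
  [IsScalarTower ℂ ℂ[G] M] [IsSmoothModule G M]

/-- A smooth module supported on `W` is generated by its parts supported on the level sets of a
locally constant function `f` on `W`. Otherwise some nonzero map from `M` to an irreducible `π` kills
all these parts. There are `K` and a nonzero `u : π.mod` such that `f σ = f π` for all `σ ∈ W` in
`containing K u`. By semisimplicity over `ℂ[K]`, some preimage of `u` in `M` satisfies the relations
of `u`, so it generates a submodule supported on the level set of `f π`, although it is not
killed. -/
theorem iSup_part_level_eq_top {W : Set (SmoothDual G)} {f : W → ℂ} (hf : IsLocallyConstant f)
    (hM : SupportedOn W M) : ⨆ c, part (level f c) M = ⊤ := by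
  rw [Submodule.eq_top_iff']
  intro v
  by_contra hv
  have hv' : (⨆ c, part (level f c) M).mkQ v ≠ 0 := fun h =>
    hv ((Submodule.Quotient.mk_eq_zero _).1 h)
  obtain ⟨π, ψ, hψ⟩ := exists_linearMap_mod_apply_ne_zero (G := G) hv'
  let φ : M →ₗ[ℂ[G]] π.mod := ψ ∘ₗ (⨆ c, part (level f c) M).mkQ
  have hφ0 : φ ≠ 0 := fun h => hψ (LinearMap.congr_fun h v)
  have hφker : ∀ x ∈ ⨆ c, part (level f c) M, φ x = 0 := fun x hx => by
    have h : (⨆ c, part (level f c) M).mkQ x = 0 := (Submodule.Quotient.mk_eq_zero _).2 hx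
    change ψ _ = 0
    rw [h, map_zero]
  have hπ : π ∈ W := hM π φ hφ0
  obtain ⟨O, hO, hOf⟩ := isOpen_induced_iff.1 (hf.isOpen_fiber (f ⟨π, hπ⟩))
  have hπO : π ∈ O := by
    change (⟨π, hπ⟩ : W) ∈ Subtype.val ⁻¹' O
    rw [hOf]
    rfl
  obtain ⟨K, u, hK, hu, hKO⟩ := exists_containing_subset hO hπO
  have := isSemisimpleModule_levelAlgebra (M := M) hK.isCompact
  obtain ⟨m, rfl⟩ := LinearMap.surjective_of_ne_zero hφ0 u
  obtain ⟨w, hw, hann⟩ := exists_lift_of_isSemisimpleModule (A := levelAlgebra K)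
    (φ.restrictScalars (levelAlgebra K)) m
  have hwpart : SupportedOn (level f (f ⟨π, hπ⟩)) (Submodule.span ℂ[G] {w}) := by
    intro σ χ hχ
    have hσ : σ ∈ W := hM.of_injective _ (Submodule.subtype_injective _) σ χ hχ
    have hσO : σ ∈ O := hKO ⟨χ ⟨w, Submodule.mem_span_singleton_self w⟩, fun h0 => hχ ?_,
      fun s hs hsu => ?_⟩
    · exact ⟨⟨σ, hσ⟩, hOf.subset hσO, rfl⟩
    · refine LinearMap.ext fun ⟨x, hx⟩ => ?_
      obtain ⟨r, rfl⟩ := Submodule.mem_span_singleton.1 hx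
      have h1 := χ.map_smul r ⟨w, Submodule.mem_span_singleton_self w⟩
      rw [h0, smul_zero] at h1
      exact h1
    · rw [← map_smul]
      have h1 : s • w = 0 := hann ⟨s, hs⟩ hsu
      rw [show s • (⟨w, Submodule.mem_span_singleton_self w⟩ : Submodule.span ℂ[G] {w}) = 0 from
        Subtype.ext h1, map_zero]
  refine hu (hw.symm.trans (hφker w ?_))
  exact Submodule.mem_iSup_of_mem _ (le_part hwpart (Submodule.mem_span_singleton_self w))

theorem iSupIndep_part_level {W : Set (SmoothDual G)} (f : W → ℂ) :
    iSupIndep fun c => part (level f c) M := fun c => by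
  refine (disjoint_part (S := level f c) (T := ⋃ d ≠ c, level f d) ?_).mono_right
    (iSup₂_le fun d hd => part_mono (Set.subset_biUnion_of_mem (u := level f) hd))
  exact Set.disjoint_iUnion₂_right.2 fun d hd => disjoint_level f hd.symm

variable (M) in
/-- The endomorphism of a smooth module supported on `W` by which a locally constant function on `W`
acts. -/
theorem exists_end_forall_part_level {W : Set (SmoothDual G)} {f : W → ℂ}
    (hf : IsLocallyConstant f) (hM : SupportedOn W M) :
    ∃ z : M →ₗ[ℂ[G]] M, ∀ c, ∀ x ∈ part (level f c) M, z x = c • x := by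
  classical
  have hcomm : SMulCommClass ℂ[G] ℂ M := IsScalarTower.to_smulCommClass'
  have hint := DirectSum.isInternal_submodule_of_iSupIndep_of_iSup_eq_top
    (iSupIndep_part_level (M := M) f) (iSup_part_level_eq_top hf hM)
  let e := LinearEquiv.ofBijective (DirectSum.coeLinearMap fun c => part (level f c) M) hint
  let d : (DirectSum ℂ fun c => part (level f c) M) →ₗ[ℂ[G]] M :=
    DirectSum.toModule ℂ[G] ℂ M fun c => c • (part (level f c) M).subtype
  refine ⟨d ∘ₗ e.symm.toLinearMap, fun c x hx => ?_⟩
  have h1 : e (DirectSum.lof ℂ[G] ℂ (fun c => part (level f c) M) c ⟨x, hx⟩) = x :=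
    DirectSum.coeLinearMap_lof _ _ _
  have h2 : e.symm x = DirectSum.lof ℂ[G] ℂ (fun c => part (level f c) M) c ⟨x, hx⟩ :=
    e.symm_apply_eq.2 h1.symm
  rw [LinearMap.comp_apply, LinearEquiv.coe_coe, h2, DirectSum.toModule_lof]
  rfl

end LocallyConstant

/-! ### The center -/

section Center

variable {G : Type u} [Group G]

/-- The action of an element of the center of a full subcategory on the `ℂ[G]`-module of one of its
objects. -/
noncomputable def centerLinear {P : ObjectProperty (Rep.{u} ℂ G)} (z : CatCenter P.FullSubcategory)
    {M : Rep.{u} ℂ G} (hM : P M) : M.ρ.asModule →ₗ[ℂ[G]] M.ρ.asModule :=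
  linearOfHom (z.app ⟨M, hM⟩).hom

theorem centerLinear_naturality {P : ObjectProperty (Rep.{u} ℂ G)}
    (z : CatCenter P.FullSubcategory) {M N : Rep.{u} ℂ G} (hM : P M) (hN : P N)
    (f : M.ρ.asModule →ₗ[ℂ[G]] N.ρ.asModule) (x : M.ρ.asModule) :
    f (centerLinear z hM x) = centerLinear z hN (f x) := by
  have h := z.naturality (X := ⟨M, hM⟩) (Y := ⟨N, hN⟩) (ObjectProperty.homMk (homOfLinear f))
  exact (DFunLike.congr_fun (congrArg (fun t => linearOfHom t.hom) h) x).symm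

/-- A family of `ℂ[G]`-linear endomorphisms which commutes with all `ℂ[G]`-linear maps comes from the
center. -/
theorem exists_center_of_linear {P : ObjectProperty (Rep.{u} ℂ G)}
    (ζ : ∀ M : Rep.{u} ℂ G, P M → (M.ρ.asModule →ₗ[ℂ[G]] M.ρ.asModule))
    (hζ : ∀ (M N : Rep.{u} ℂ G) (hM : P M) (hN : P N)
      (f : M.ρ.asModule →ₗ[ℂ[G]] N.ρ.asModule), f ∘ₗ ζ M hM = ζ N hN ∘ₗ f) :
    ∃ z : CatCenter P.FullSubcategory, ∀ M hM, centerLinear z hM = ζ M hM := by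
  refine ⟨{ app := fun X => ObjectProperty.homMk (homOfLinear (ζ X.1 X.2)),
            naturality := fun X Y f => ?_ }, fun M hM => rfl⟩
  refine ObjectProperty.hom_ext _ (Rep.hom_ext ?_)
  refine (Representation.IntertwiningMap.equivLinearMapAsModule X.1.ρ Y.1.ρ).injective ?_
  exact (hζ X.1 Y.1 X.2 Y.2 (linearOfHom f.hom)).symm

theorem smul_mk_one {J : Submodule ℂ[G] ℂ[G]} (r : ℂ[G]) :
    r • (Submodule.Quotient.mk 1 : ℂ[G] ⧸ J) = Submodule.Quotient.mk r := by
  rw [← Submodule.Quotient.mk_smul, smul_eq_mul, mul_one]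

variable [TopologicalSpace G]

theorem smooth_eq_smoothOn_univ : smooth G = smoothOn Set.univ :=
  funext fun _ => propext ⟨fun h => ⟨h, Set.subset_univ _⟩, fun h => h.1⟩

variable [IsEllCGroup G] [IsTame G]

theorem centerLinear_mod {P : ObjectProperty (Rep.{u} ℂ G)} (z : CatCenter P.FullSubcategory)
    {π : SmoothDual G} (hπ : P π.rep) (x : π.mod) :
    centerLinear z hπ x = scalar π (centerApp P π.rep hπ z) • x := by
  have h : algebraMap ℂ (End π.rep) (scalar π (centerApp P π.rep hπ z)) =
      centerApp P π.rep hπ z := (scalar π).symm_apply_apply _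
  exact (congrArg (fun t : End π.rep => linearOfHom (t : π.rep ⟶ π.rep) x) h).symm

theorem scalar_eq_of_smul_eq {P : ObjectProperty (Rep.{u} ℂ G)} (z : CatCenter P.FullSubcategory)
    {π : SmoothDual G} (hπ : P π.rep) {c : ℂ} {x : π.mod} (hx : x ≠ 0)
    (h : centerLinear z hπ x = c • x) : scalar π (centerApp P π.rep hπ z) = c :=
  smul_left_injective ℂ hx ((centerLinear_mod z hπ x).symm.trans h)

/-- Every locally constant function on `W` comes from the center. -/
theorem exists_center_of_isLocallyConstant {P : ObjectProperty (Rep.{u} ℂ G)}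
    {W : Set (SmoothDual G)} (hP : P = smoothOn W) {f : W → ℂ} (hf : IsLocallyConstant f) :
    ∃ z : CatCenter P.FullSubcategory, ∀ (π : SmoothDual G) (hπ : P π.rep) (hW : π ∈ W),
      scalar π (centerApp P π.rep hπ z) = f ⟨π, hW⟩ := by
  subst hP
  have hsm : ∀ M, smoothOn W M → IsSmoothModule G M.ρ.asModule := fun M hM => (smoothOn_iff.1 hM).1
  have hsupp : ∀ M, smoothOn W M → SupportedOn W M.ρ.asModule := fun M hM => (smoothOn_iff.1 hM).2
  choose ζ hζ using fun (M : Rep.{u} ℂ G) (hM : smoothOn W M) =>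
    have := hsm M hM
    exists_end_forall_part_level M.ρ.asModule hf (hsupp M hM)
  obtain ⟨z, hz⟩ := exists_center_of_linear ζ fun M N hM hN g => by
    have := hsm M hM
    refine LinearMap.ext fun x => ?_
    have hx : x ∈ ⨆ c, part (level f c) M.ρ.asModule :=
      iSup_part_level_eq_top hf (hsupp M hM) ▸ Submodule.mem_top
    induction hx using Submodule.iSup_induction' with
    | mem c x hx =>
      have hcomm : ∀ y, g (c • y) = c • g y := (g.restrictScalars ℂ).map_smul c
      rw [LinearMap.comp_apply, LinearMap.comp_apply, hζ M hM c x hx,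
        hζ N hN c _ (map_mem_part g hx), hcomm]
    | zero => rw [map_zero, map_zero]
    | add x y _ _ hx hy => rw [map_add, map_add, hx, hy]
  refine ⟨z, fun π hπ hW => ?_⟩
  obtain ⟨x, hx⟩ := exists_ne_zero_mod π
  refine scalar_eq_of_smul_eq z hπ hx ?_
  rw [hz]
  refine hζ _ _ _ _ ?_
  have hlev : π ∈ level f (f ⟨π, hW⟩) := ⟨⟨π, hW⟩, rfl, rfl⟩
  rw [part_eq_top (supportedOn_mod hlev)]
  exact Submodule.mem_top

/-- The relations satisfied by all vectors of members of `W` which satisfy the relations of `v` over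
`K`. -/
def relations (W : Set (SmoothDual G)) (K : Subgroup G) {M : Type*} [AddCommGroup M]
    [Module ℂ[G] M] (v : M) : Submodule ℂ[G] ℂ[G] where
  carrier := {r | ∀ σ ∈ W, ∀ u : σ.mod, (∀ s ∈ levelAlgebra K, s • v = 0 → s • u = 0) → r • u = 0}
  add_mem' ha hb σ hσ u hu := by rw [add_smul, ha σ hσ u hu, hb σ hσ u hu, add_zero]
  zero_mem' σ _ u _ := zero_smul _ u
  smul_mem' t r hr σ hσ u hu := by rw [smul_eq_mul, mul_smul, hr σ hσ u hu, smul_zero]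

/-- The quotient of `ℂ[G]` by the common relations is the largest cyclic module, generated by a vector
satisfying the relations of `v` over `K`, which embeds into a product of members of `O ∩ C`. It is
supported on `O ∩ C`. Indeed, the generator shows that its irreducible quotients are in
`containing K v`. If one of them, `τ`, is not in `C`, some set `containing K' u` with `u : τ.mod`
misses `C`; but `u` lifts to a vector of the quotient satisfying the relations of `u` over `K'`, and
this is nonzero in some member of `O ∩ C`. -/
theorem supportedOn_quotient_relations {O C : Set (SmoothDual G)} (hC : IsClosed C)
    {K : Subgroup G} {M : Type*} [AddCommGroup M] [Module ℂ[G] M] {v : M}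
    (hKO : containing K v ⊆ O) [IsSmoothModule G (ℂ[G] ⧸ relations (O ∩ C) K v)] :
    SupportedOn (O ∩ C) (ℂ[G] ⧸ relations (O ∩ C) K v) := by
  intro τ φ hφ
  refine ⟨hKO ⟨φ (Submodule.Quotient.mk 1), fun h0 => hφ (LinearMap.ext fun x => ?_),
    fun s hs hsv => ?_⟩, ?_⟩
  · obtain ⟨r, rfl⟩ := Submodule.Quotient.mk_surjective _ x
    rw [← smul_mk_one, map_smul, h0, smul_zero]
    rfl
  · rw [← map_smul, smul_mk_one, (Submodule.Quotient.mk_eq_zero _).2, map_zero]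
    exact fun σ _ u hu => hu s hs hsv
  · by_contra hτ
    obtain ⟨K', u, hK', hu, hKC⟩ := exists_containing_subset hC.isOpen_compl hτ
    have := isSemisimpleModule_levelAlgebra (M := ℂ[G] ⧸ relations (O ∩ C) K v) hK'.isCompact
    obtain ⟨m, rfl⟩ := LinearMap.surjective_of_ne_zero hφ u
    obtain ⟨x, hx, hann⟩ := exists_lift_of_isSemisimpleModule (A := levelAlgebra K')
      (φ.restrictScalars (levelAlgebra K')) m
    obtain ⟨r, rfl⟩ := Submodule.Quotient.mk_surjective _ x
    have hr : r ∉ relations (O ∩ C) K v := fun hr => hu (by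
      rw [← LinearMap.coe_restrictScalars (levelAlgebra K'), ← hx,
        (Submodule.Quotient.mk_eq_zero _).2 hr, map_zero])
    have hr' : ∃ σ ∈ O ∩ C, ∃ w : σ.mod, (∀ s ∈ levelAlgebra K, s • v = 0 → s • w = 0) ∧
        r • w ≠ 0 := by
      by_contra! h
      exact hr h
    obtain ⟨σ, hσ, w, hw, hrw⟩ := hr'
    refine hKC (⟨r • w, hrw, fun s hs hsu => ?_⟩ : σ ∈ containing K' (φ m)) hσ.2
    have h1 : s • (Submodule.Quotient.mk r : ℂ[G] ⧸ relations (O ∩ C) K v) = 0 :=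
      hann ⟨s, hs⟩ hsu
    rw [← Submodule.Quotient.mk_smul, Submodule.Quotient.mk_eq_zero, smul_eq_mul] at h1
    rw [← mul_smul]
    exact h1 σ hσ w hw

/-- The center acts on `W` by locally constant functions if `W` is locally closed: near `π`, the
action is given by the action of a single element of a group algebra `ℂ[K]` on vectors generating
a fixed representation of `K`. -/
theorem isLocallyConstant_scalar_centerApp {P : ObjectProperty (Rep.{u} ℂ G)}
    {W : Set (SmoothDual G)} (hP : P = smoothOn W) (hW : IsLocallyClosed W)
    (z : CatCenter P.FullSubcategory) (hrep : ∀ π : W, P π.1.rep) :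
    IsLocallyConstant fun π : W => scalar π.1 (centerApp P π.1.rep (hrep π) z) := by
  subst hP
  obtain ⟨O, C, hO, hC, rfl⟩ := hW
  rw [IsLocallyConstant.iff_eventually_eq]
  intro π
  obtain ⟨K₀, v, hK₀, hv, hKO⟩ := exists_containing_subset hO π.2.1
  let J := relations (O ∩ C) K₀ v
  have : IsSmoothModule G (ℂ[G] ⧸ J) :=
    isSmoothModule_quotient (L := K₀ ⊓ stab G v)
      (hK₀.isOpen.inter (IsSmoothModule.isOpen_stab v)) fun l hl σ _ u hu => hu _
        (sub_mem (single_mem_levelAlgebra hl.1 1) (one_mem _))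
        (single_sub_one_smul_eq_zero.2 hl.2)
  have hM : smoothOn (O ∩ C) (repOf G (ℂ[G] ⧸ J)) := smoothOn_iff.2
    ⟨.of_injective (repOfEquiv G _).toLinearMap (repOfEquiv G _).injective,
      (supportedOn_quotient_relations hC hKO).of_surjective
        (repOfEquiv G _).symm.toLinearMap (repOfEquiv G _).symm.surjective⟩
  -- `z` maps the generator of `ℂ[G] ⧸ J` to the class of some `r`
  obtain ⟨r, hr⟩ := Submodule.Quotient.mk_surjective J
    (repOfEquiv G _ (centerLinear z hM ((repOfEquiv G _).symm (Submodule.Quotient.mk 1))))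
  have hact : ∀ (σ : SmoothDual G) (hσ : σ ∈ O ∩ C) (u : σ.mod),
      (∀ s ∈ levelAlgebra K₀, s • v = 0 → s • u = 0) →
        scalar σ (centerApp _ σ.rep (hrep ⟨σ, hσ⟩) z) • u = r • u := by
    intro σ hσ u hu
    let g : (ℂ[G] ⧸ J) →ₗ[ℂ[G]] σ.mod := Submodule.liftQ J (LinearMap.toSpanSingleton ℂ[G] _ u)
      fun t ht => ht σ hσ u hu
    have h := centerLinear_naturality z hM (hrep ⟨σ, hσ⟩)
      (g ∘ₗ (repOfEquiv G _).toLinearMap) ((repOfEquiv G _).symm (Submodule.Quotient.mk 1))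
    rw [centerLinear_mod, LinearMap.comp_apply, LinearMap.comp_apply, LinearEquiv.coe_coe, ← hr,
      LinearEquiv.apply_symm_apply] at h
    have h1 : g (Submodule.Quotient.mk 1) = u := one_smul ℂ[G] u
    rw [h1] at h
    exact h.symm
  -- once `r` lies in `ℂ[K]`, acting on `v` by a given scalar is a relation over `ℂ[K]`
  obtain ⟨K₁, hK₁, hrK₁⟩ := exists_mem_levelAlgebra r
  obtain ⟨K, hK, h₀, h₁⟩ := exists_isCompactOpen_sup hK₀ hK₁
  filter_upwards [continuous_subtype_val.continuousAt.preimage_mem_nhds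
    (containing_mem_nhds hK hv)] with σ ⟨u, hu, hvu⟩
  let c := scalar π.1 (centerApp _ π.1.rep (hrep π) z)
  have hcv : (r - algebraMap ℂ ℂ[G] c) • v = 0 := by
    rw [sub_smul, algebraMap_smul, ← hact π.1 π.2 v fun s _ hs => hs, sub_self]
  have hcu := hvu _ (sub_mem (levelAlgebra_mono h₁ hrK₁) (Subalgebra.algebraMap_mem _ c)) hcv
  rw [sub_smul, algebraMap_smul, sub_eq_zero, ← hact σ.1 σ.2 u
    fun s hs => hvu s (levelAlgebra_mono h₀ hs)] at hcu
  exact smul_left_injective ℂ hu hcu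

/-- The Bernstein center acts faithfully on the irreducible representations, since vectors of smooth
modules are separated by maps to irreducible ones. -/
theorem centerToFun_injective : Function.Injective (centerToFun G) := by
  rw [injective_iff_map_eq_zero]
  intro z hz
  refine CatCenter.ext _ _ fun X => ?_
  have : IsSmoothModule G X.1.ρ.asModule := (isSmoothModule_asModule_iff _).2 X.2
  have hzero : centerLinear z X.2 = 0 := by
    refine LinearMap.ext fun x => ?_
    by_contra hx
    obtain ⟨π, f, hf⟩ := exists_linearMap_mod_apply_ne_zero (G := G) hx
    refine hf ?_
    rw [centerLinear_naturality z X.2 (smooth_rep π) f x, centerLinear_mod]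
    have h : scalar π (centerApp (smooth G) π.rep (smooth_rep π) z) = 0 := congrFun hz π
    rw [h, zero_smul]
  refine ObjectProperty.hom_ext _ (Rep.hom_ext ?_)
  refine (Representation.IntertwiningMap.equivLinearMapAsModule X.1.ρ X.1.ρ).injective ?_
  exact hzero

theorem isLocallyConstant_centerToFun (z : BernsteinCenter G) :
    IsLocallyConstant (centerToFun G z) := by
  have h := isLocallyConstant_scalar_centerApp smooth_eq_smoothOn_univ isOpen_univ.isLocallyClosed z
    fun π => smooth_rep π.1
  exact h.comp_continuous (f := fun π : SmoothDual G => (⟨π, Set.mem_univ π⟩ : Set.univ))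
    (by fun_prop)

theorem exists_centerToFun_eq {f : SmoothDual G → ℂ} (hf : IsLocallyConstant f) :
    ∃ z, centerToFun G z = f := by
  obtain ⟨z, hz⟩ := exists_center_of_isLocallyConstant smooth_eq_smoothOn_univ
    (hf.comp_continuous continuous_subtype_val)
  exact ⟨z, funext fun π => hz π (smooth_rep π) (Set.mem_univ π)⟩

end Center

end SmoothRep

theorem mainTheorem1 {G : Type u} [Group G] [TopologicalSpace G]
    [SmoothRep.IsEllCGroup G] [SmoothRep.IsTame G] :
    (∀ W : Set (SmoothRep.SmoothDual G), IsLocallyClosed W →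
      Set.range (SmoothRep.centerToFunOn W) = {f : W → ℂ | IsLocallyConstant f}) ∧
    ∃ e : SmoothRep.BernsteinCenter G ≃ₐ[ℂ] LocallyConstant (SmoothRep.SmoothDual G) ℂ,
      ∀ z : SmoothRep.BernsteinCenter G,
        (e z : SmoothRep.SmoothDual G → ℂ) = SmoothRep.centerToFun G z := by
  constructor
  · intro W hW
    refine Set.Subset.antisymm ?_ fun f hf => ?_
    · rintro _ ⟨z, rfl⟩
      exact SmoothRep.isLocallyConstant_scalar_centerApp rfl hW z SmoothRep.smoothOn_rep
    · obtain ⟨z, hz⟩ := SmoothRep.exists_center_of_isLocallyConstant rfl hf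
      exact ⟨z, funext fun π => hz π.1 (SmoothRep.smoothOn_rep π) π.2⟩
  · let F : SmoothRep.BernsteinCenter G →ₐ[ℂ] LocallyConstant (SmoothRep.SmoothDual G) ℂ :=
      { toFun := fun z => ⟨SmoothRep.centerToFun G z, SmoothRep.isLocallyConstant_centerToFun z⟩
        map_one' := LocallyConstant.coe_injective (map_one (SmoothRep.centerToFun G))
        map_mul' := fun a b => LocallyConstant.coe_injective (map_mul (SmoothRep.centerToFun G) a b)
        map_zero' := LocallyConstant.coe_injective (map_zero (SmoothRep.centerToFun G))
        map_add' := fun a b => LocallyConstant.coe_injective (map_add (SmoothRep.centerToFun G) a b)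
        commutes' := fun c =>
          LocallyConstant.coe_injective ((SmoothRep.centerToFun G).commutes c) }
    refine ⟨AlgEquiv.ofBijective F ⟨fun a b hab => ?_, fun f => ?_⟩, fun z => rfl⟩
    · exact SmoothRep.centerToFun_injective (congrArg DFunLike.coe hab)
    · obtain ⟨z, hz⟩ := SmoothRep.exists_centerToFun_eq f.isLocallyConstant
      exact ⟨z, LocallyConstant.coe_injective hz⟩
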